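/- Let $f,g:\mathbb{R}^{d_x}\times\mathbb{R}^{d_y}\to\mathbb{R}$ and $h=(h_1,\dots,h_{d_h}):\mathbb{R}^{d_x}\times\mathbb{R}^{d_y}\to\mathbb{R}^{d_h}$ be continuously differentiable, put $\mathcal{Y}(x)=\{y\in\mathbb{R}^{d_y}: h(x,y)\le 0\}$ and $S=\{(x,y): y\in\mathcal{Y}(x)\}$, and let the gradients of $f$, $g$ and all $h_i$ be differentiable at every point of $S$. Norms are Euclidean for vectors and spectral for matrices. For $t\ge 0$ and $\delta>0$ write $$y^*(x)=\operatorname*{argmin}_{y\in\mathcal{Y}(x)} g(x,y),\qquad y^*_t(x)=\operatorname*{argmin}_{y\in\mathcal{Y}(x)} \bigl(t f(x,y)+g(x,y)\bigr),$$ $$\Phi(x)=f(x,y^*(x)),\qquad \Phi_\delta(x)=\min_{y\in\mathcal{Y}(x)}\max_{z\in\mathcal{Y}(x)}\Bigl(f(x,y)+\tfrac1\delta\bigl[g(x,y)-g(x,z)\bigr]\Bigr).$$ Assume: (a) for every $x\in\mathbb{R}^{d_x}$ the set $\mathcal{Y}(x)$ is nonempty, closed and convex, and $\Phi$ is bounded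 below; (b) on $S$, jointly in $(x,y)$, the maps $f,\nabla f,\nabla^2 f$ are Lipschitz with constants $l_{f,0},l_{f,1},l_{f,2}$; $\nabla g,\nabla^2 g$ are Lipschitz with constants $l_{g,1},l_{g,2}$; and, for each $i$, $h_i,\nabla h_i,\nabla^2h_i$ are Lipschitz with constants $l_{h,0},l_{h,1},l_{h,2}$; (c) for every $x$, $g(x,\cdot)$ is $\mu_g$-strongly convex on $\mathcal{Y}(x)$, where $\mu_g>0$, and each $h_i(x,\cdot)$ is convex on $\mathbb{R}^{d_y}$. Let $\delta>0$ with $2l_{f,1}\delta\le\mu_g$ (that is, $\delta\le\mu_g/(2l_{f,1})$ if $l_{f,1}>0$). Fix $x$, let $\mathcal{I}=\{i: h_i(x,y^*(x))=0\}$, and let $\Lambda,s_{\max}$ and $s_{\min}>0$ be constants. Suppose that for every $t\in[0,\delta]$: (1) the active set $\{i: h_i(x,y^*_t(x))=0\}$ equals $\mathcal{I}$, and the vectors $\nabla_y h_i(x,y^*_t(x))$, $i\in\mathcal{I}$, are linearly independent (LICQ); (2) the Lagrange multiplier $\lambda^*_t(x)\in\mathbb{R}^{d_h}$ at $y^*_t(x)$,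 i.e. the vector $\lambda\ge 0$ with $\lambda_i h_i(x,y^*_t(x))=0$ for all $i$ and $t\nabla_y f(x,y^*_t(x))+\nabla_y g(x,y^*_t(x))+\sum_i\lambda_i\nabla_y h_i(x,y^*_t(x))=0$, satisfies $[\lambda^*_t(x)]_i>0$ for all $i\in\mathcal{I}$ and $\|\lambda^*_t(x)\|\le\Lambda$; (3) the $|\mathcal{I}|$ singular values of the $|\mathcal{I}|\times d_y$ matrix with rows $\nabla_y h_i(x,y^*_t(x))^\top$, $i\in\mathcal{I}$, lie in $[s_{\min},s_{\max}]$. Then $\Phi$ and $\Phi_\delta$ are differentiable at $x$ and $$\|\nabla\Phi(x)-\nabla\Phi_\delta(x)\|\le C\,\delta,$$ where $C$ depends only on $d_h$, $\mu_g$, $l_{f,0},l_{f,1},l_{f,2}$, $l_{g,1},l_{g,2}$, $l_{h,0},l_{h,1},l_{h,2}$, $\Lambda$, $s_{\min}$ and $s_{\max}$. -/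

import Mathlib

open scoped NNReal

noncomputable section

namespace CoupledBilevel

/-- `ℝ^n` with the Euclidean norm. -/
abbrev Vec (n : ℕ) : Type := EuclideanSpace ℝ (Fin n)

/-- The joint space `ℝ^dx × ℝ^dy` with the Euclidean (`ℓ²`) norm. -/
abbrev Joint (dx dy : ℕ) : Type := WithLp 2 (Vec dx × Vec dy)

/-- A function of two vector variables, seen as a function on the joint space. -/
def joint {dx dy : ℕ} (F : Vec dx → Vec dy → ℝ) (p : Joint dx dy) : ℝ := F p.fst p.snd

/-- The Hessian of `F` at `p`: the derivative of the gradient field, as a linear operator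
(its operator norm is the spectral norm of the Hessian matrix). -/
def hessian {E : Type*} [NormedAddCommGroup E] [InnerProductSpace ℝ E] [CompleteSpace E]
    (F : E → ℝ) (p : E) : E →L[ℝ] E := fderiv ℝ (gradient F) p

/-- The minimizer of `φ` over `s` (an arbitrary point if there is none). -/
def argminOn {E : Type*} [Nonempty E] (s : Set E) (φ : E → ℝ) : E :=
  Classical.epsilon fun y => y ∈ s ∧ IsMinOn φ s y

/-- The data of a bilevel problem: upper-level objective `f`, lower-level objective `g` and
coupled constraint functions `h i`. -/
structure Problem (dx dy m : ℕ) where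
  /-- upper-level objective -/
  f : Vec dx → Vec dy → ℝ
  /-- lower-level objective -/
  g : Vec dx → Vec dy → ℝ
  /-- constraint functions -/
  h : Fin m → Vec dx → Vec dy → ℝ

/-- The constants that occur in the assumptions. -/
structure Constants where
  /-- Lipschitz constant of `f` -/
  lf0 : ℝ≥0
  /-- Lipschitz constant of `∇f` -/
  lf1 : ℝ≥0
  /-- Lipschitz constant of `∇²f` -/
  lf2 : ℝ≥0
  /-- Lipschitz constant of `∇g` -/
  lg1 : ℝ≥0
  /-- Lipschitz constant of `∇²g` -/
  lg2 : ℝ≥0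
  /-- Lipschitz constant of each `h i` -/
  lh0 : ℝ≥0
  /-- Lipschitz constant of each `∇(h i)` -/
  lh1 : ℝ≥0
  /-- Lipschitz constant of each `∇²(h i)` -/
  lh2 : ℝ≥0
  /-- modulus of strong convexity of `g` in `y` -/
  μg : ℝ
  /-- bound on the multipliers -/
  Λ : ℝ
  /-- lower bound on the singular values of the active Jacobian -/
  smin : ℝ
  /-- upper bound on the singular values of the active Jacobian -/
  smax : ℝ

namespace Problem

variable {dx dy m : ℕ} (P : Problem dx dy m)

/-- `Y(x) = {y | h(x,y) ≤ 0}`. -/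
def feasible (x : Vec dx) : Set (Vec dy) := {y | ∀ i, P.h i x y ≤ 0}

/-- The set of all `(x,y)` with `y ∈ Y(x)`, over which the Lipschitz assumptions are made. -/
def domain : Set (Joint dx dy) := {p | p.snd ∈ P.feasible p.fst}

/-- `g_t(x,y) = t f(x,y) + g(x,y)`. -/
def gPen (t : ℝ) (x : Vec dx) (y : Vec dy) : ℝ := t * P.f x y + P.g x y

/-- `y*(x)`, the minimizer of `g(x,·)` over `Y(x)`. -/
def yStar (x : Vec dx) : Vec dy := argminOn (P.feasible x) (P.g x)

/-- `y*_t(x)`, the minimizer of `t f(x,·) + g(x,·)` over `Y(x)`. -/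
def yStarPen (t : ℝ) (x : Vec dx) : Vec dy := argminOn (P.feasible x) (P.gPen t x)

/-- The hyper-objective `Φ(x) = f(x, y*(x))`. -/
def Φ (x : Vec dx) : ℝ := P.f x (P.yStar x)

/-- `Φ_δ(x) = min_{y ∈ Y(x)} max_{z ∈ Y(x)} f(x,y) + (g(x,y) - g(x,z)) / δ`. -/
def ΦPen (δ : ℝ) (x : Vec dx) : ℝ :=
  ⨅ y : P.feasible x, ⨆ z : P.feasible x, P.f x y + (1 / δ) * (P.g x y - P.g x z)

open Classical in
/-- Indices of the constraints that are active at `y`, for the parameter `x`. -/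
def activeSet (x : Vec dx) (y : Vec dy) : Finset (Fin m) :=
  Finset.univ.filter fun i => P.h i x y = 0

/-- Linear independence of the gradients in `y` of the active constraints. -/
def LICQ (x : Vec dx) (y : Vec dy) : Prop :=
  LinearIndependent ℝ fun i : P.activeSet x y => gradient (P.h i x) y

/-- `lam` is a Lagrange multiplier at `y` for minimizing `g_t(x,·)` subject to `h(x,·) ≤ 0`:
it satisfies the Karush-Kuhn-Tucker conditions together with `y`. -/
def IsMultiplier (t : ℝ) (x : Vec dx) (y : Vec dy) (lam : Vec m) : Prop :=
  (∀ i, 0 ≤ lam i) ∧ (∀ i, lam i * P.h i x y = 0) ∧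
    gradient (P.gPen t x) y + ∑ i, lam i • gradient (P.h i x) y = 0

/-- The Jacobian in `y` of the active constraints, one row for each active constraint. -/
def activeJacobian (x : Vec dx) (y : Vec dy) : Matrix (P.activeSet x y) (Fin dy) ℝ :=
  Matrix.of fun i j => gradient (P.h i x) y j

/-- All singular values of the active Jacobian lie in `[smin, smax]`. Under LICQ that matrix
has as many singular values as it has rows. -/
def JacobianBounds (c : Constants) (x : Vec dx) (y : Vec dy) : Prop :=
  ∀ k < (P.activeSet x y).card,
    c.smin ≤ (Matrix.toEuclideanLin (P.activeJacobian x y)).singularValues k ∧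
      (Matrix.toEuclideanLin (P.activeJacobian x y)).singularValues k ≤ c.smax

/-- `F` is continuously differentiable and its gradient is differentiable at all points
of `S` (so that the Hessian exists there). -/
def HasHessianOn (S : Set (Joint dx dy)) (F : Vec dx → Vec dy → ℝ) : Prop :=
  ContDiff ℝ 1 (joint F) ∧ ∀ p ∈ S, DifferentiableAt ℝ (gradient (joint F)) p

/-- The assumptions on the problem that do not refer to a particular `x`. -/
structure Standing (c : Constants) : Prop where
  nonempty : ∀ x, (P.feasible x).Nonempty
  closed : ∀ x, IsClosed (P.feasible x)
  convex : ∀ x, Convex ℝ (P.feasible x)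
  bddBelow : BddBelow (Set.range P.Φ)
  hess_f : HasHessianOn P.domain P.f
  hess_g : HasHessianOn P.domain P.g
  hess_h : ∀ i, HasHessianOn P.domain (P.h i)
  lip_f : LipschitzOnWith c.lf0 (joint P.f) P.domain
  lip_grad_f : LipschitzOnWith c.lf1 (gradient (joint P.f)) P.domain
  lip_hess_f : LipschitzOnWith c.lf2 (hessian (joint P.f)) P.domain
  lip_grad_g : LipschitzOnWith c.lg1 (gradient (joint P.g)) P.domain
  lip_hess_g : LipschitzOnWith c.lg2 (hessian (joint P.g)) P.domain
  lip_h : ∀ i, LipschitzOnWith c.lh0 (joint (P.h i)) P.domain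
  lip_grad_h : ∀ i, LipschitzOnWith c.lh1 (gradient (joint (P.h i))) P.domain
  lip_hess_h : ∀ i, LipschitzOnWith c.lh2 (hessian (joint (P.h i))) P.domain
  strongConvex_g : ∀ x, StrongConvexOn (P.feasible x) c.μg (P.g x)
  convex_h : ∀ i x, ConvexOn ℝ Set.univ (P.h i x)

/-- The assumptions at the given point `x`, for every `t ∈ [0, δ]`: LICQ, constancy of the
active set, strict complementarity, bounded multipliers, bounded singular values. -/
structure RegularAt (c : Constants) (δ : ℝ) (x : Vec dx) : Prop where
  licq : ∀ t ∈ Set.Icc 0 δ, P.LICQ x (P.yStarPen t x)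
  active_eq : ∀ t ∈ Set.Icc 0 δ,
    P.activeSet x (P.yStarPen t x) = P.activeSet x (P.yStar x)
  strict_compl : ∀ t ∈ Set.Icc 0 δ, ∀ lam, P.IsMultiplier t x (P.yStarPen t x) lam →
    ∀ i ∈ P.activeSet x (P.yStar x), 0 < lam i
  mult_le : ∀ t ∈ Set.Icc 0 δ, ∀ lam, P.IsMultiplier t x (P.yStarPen t x) lam → ‖lam‖ ≤ c.Λ
  jacobian : ∀ t ∈ Set.Icc 0 δ, P.JacobianBounds c x (P.yStarPen t x)

end Problem

end CoupledBilevel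

end

/-!
The penalized hyper-objective is a difference quotient of optimal values: with
`v_t x = min (t f + g)` over the feasible set at `x`, one has `Φ_δ = (v_δ - v_0) / δ`
(`Standing.ΦPen_eq`).

*Differentiability.* At a regular parameter the minimizer is a differentiable function of the
parameter (`IsProgram.exists_hasFDerivAt`). It is continuous there, by a quantitative stability
estimate based on strong convexity and on a Slater direction supplied by linear independence of
the active gradients (`IsProgram.continuousAt_minimizer`). The multipliers then converge as well,
so by strict complementarity the same constraints are active at all nearby parameters, and
minimizer and multiplier solve a square system of equations. The data need not be twice
continuously differentiable near the base point, so the implicit function theorem is not available;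
but a continuous branch of solutions is already at hand, and differentiability of the system at the
base point together with injectivity of its partial derivative suffices
(`exists_hasFDerivAt_of_eventually_eq_zero`). This gives the derivative of `Φ`, and the envelope
formula `IsProgram.gradient_value` gives the gradients of `v_0` and `v_δ`: each is the
parameter part of the joint gradient `K_t` of the Lagrangian of `t f + g`, whose `y`-part vanishes.

*Comparison.* Let `ζ = (ξ, D ξ)` be a tangent direction, `D` being the derivative of `y*`, and let
`ε` be the derivative of the multiplier along `ξ`. Then `⟪∇Φ, ξ⟫ = ⟪∇f, ζ⟫` and
`δ ⟪∇Φ_δ, ξ⟫ = ⟪K_δ - K_0, ζ⟫`. Expand `K_δ - K_0` to first order in the displacements of minimizer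
and multiplier, which are `O(δ)`. The term `δ ∇f` is the contribution of `Φ`. The change of the
multiplier multiplies the active gradients, which are orthogonal to `ζ`. The Hessian term is, by symmetry and the
linearized Karush-Kuhn-Tucker system, a combination with coefficients `ε` of inner products of the
displacement with the active gradients, and these are `O(δ²)` because the active constraints vanish
at both minimizers. All that is left is `O(δ²)` times the norms of `ζ` and `ε`, which are bounded by
the energy estimate `norm_le_of_linearized`. No derivative in `t` is needed
(`Standing.norm_gradient_sub_le`).

The Lipschitz assumptions hold on the domain only. They bound derivatives at a boundary point
because, by the Slater direction, it is a limit of interior points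
(`norm_fderiv_le_of_mem_closure_interior`).
-/

open Filter Topology Asymptotics
open scoped NNReal InnerProductSpace

noncomputable section

namespace CoupledBilevel

/-! ### Calculus and linear algebra in inner product spaces -/

section Calculus

variable {E : Type*} [NormedAddCommGroup E] [InnerProductSpace ℝ E]

lemma hasDerivAt_line_of_hasGradientAt [CompleteSpace E] {φ : E → ℝ} {G w : E} (v : E) {s : ℝ}
    (h : HasGradientAt φ G (w + s • v)) :
    HasDerivAt (fun r : ℝ => φ (w + r • v)) ⟪G, v⟫_ℝ s := by
  have hl : HasDerivAt (fun r : ℝ => w + r • v) v s := by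
    simpa using ((hasDerivAt_id s).smul_const v).const_add w
  have := (HasGradientAt.hasFDerivAt h).comp_hasDerivAt s hl
  simpa [InnerProductSpace.toDual_apply_apply, Function.comp_def] using this

/-- First-order lower bound for a strongly convex function: divide the defining inequality at
`w + r • (y - w)` by `r` and let `r` tend to `0` from the right. -/
lemma add_inner_add_le_of_strongConvexOn [CompleteSpace E] {S : Set E} {μ : ℝ} {φ : E → ℝ}
    (h : StrongConvexOn S μ φ) {w y G : E} (hw : w ∈ S) (hy : y ∈ S) (hG : HasGradientAt φ G w) :
    φ w + ⟪G, y - w⟫_ℝ + μ / 2 * ‖y - w‖ ^ 2 ≤ φ y := by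
  have hd : HasDerivAt (fun r : ℝ => φ (w + r • (y - w))) ⟪G, y - w⟫_ℝ 0 := by
    apply hasDerivAt_line_of_hasGradientAt; simpa using hG
  have hs := hd.tendsto_slope_zero_right
  have hr : Tendsto (fun r : ℝ => φ y - φ w - (1 - r) * (μ / 2 * ‖y - w‖ ^ 2)) (𝓝[>] 0)
      (𝓝 (φ y - φ w - (1 - 0) * (μ / 2 * ‖y - w‖ ^ 2))) := by
    apply Tendsto.mono_left _ nhdsWithin_le_nhds
    apply Continuous.tendsto
    fun_prop
  suffices key : ∀ᶠ r : ℝ in 𝓝[>] 0, r⁻¹ • (φ (w + (0 + r) • (y - w)) - φ (w + (0 : ℝ) • (y - w))) ≤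
      φ y - φ w - (1 - r) * (μ / 2 * ‖y - w‖ ^ 2) by
    have := le_of_tendsto_of_tendsto hs hr key
    linarith
  filter_upwards [Ioo_mem_nhdsGT (zero_lt_one : (0 : ℝ) < 1)] with r hr
  have h2 := h.2 hw hy (show 0 ≤ 1 - r by linarith [hr.2]) hr.1.le (by ring)
  have e : (1 - r) • w + r • y = w + (0 + r) • (y - w) := by
    rw [zero_add]; module
  rw [e, norm_sub_rev] at h2
  simp only [smul_eq_mul, zero_smul, add_zero] at h2 ⊢
  rw [inv_mul_le_iff₀ hr.1]
  linarith

/-- The descent inequality for a function whose gradient is Lipschitz on a convex set. -/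
lemma add_inner_sub_le_of_lipschitzOnWith [CompleteSpace E] {S : Set E} (hS : Convex ℝ S)
    {φ : E → ℝ} {G : E → E} {l : ℝ} (hG : ∀ z ∈ S, HasGradientAt φ (G z) z)
    (hl : ∀ z ∈ S, ∀ z' ∈ S, ‖G z - G z'‖ ≤ l * ‖z - z'‖) {w y : E} (hw : w ∈ S) (hy : y ∈ S) :
    φ w + ⟪G w, y - w⟫_ℝ - l / 2 * ‖y - w‖ ^ 2 ≤ φ y := by
  set v := y - w with hv
  have hmem : ∀ r ∈ Set.Icc (0 : ℝ) 1, w + r • v ∈ S := fun r hr => hS.add_smul_sub_mem hw hy hr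
  let k : ℝ → ℝ := fun r => φ (w + r • v) - r * ⟪G w, v⟫_ℝ + l / 2 * r ^ 2 * ‖v‖ ^ 2
  have hk : ∀ r ∈ Set.Icc (0 : ℝ) 1,
      HasDerivAt k (⟪G (w + r • v), v⟫_ℝ - ⟪G w, v⟫_ℝ + l * r * ‖v‖ ^ 2) r := by
    intro r hr
    have h1 := hasDerivAt_line_of_hasGradientAt v (hG _ (hmem r hr))
    have h2 := (hasDerivAt_id r).mul_const ⟪G w, v⟫_ℝ
    have h3 := (((hasDerivAt_id r).pow 2).const_mul (l / 2)).mul_const (‖v‖ ^ 2)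
    convert! (h1.sub h2).add h3 using 1
    simp only [id_eq, Nat.cast_ofNat, Nat.add_one_sub_one, pow_one]
    ring
  have hmono : MonotoneOn k (Set.Icc 0 1) := by
    apply monotoneOn_of_deriv_nonneg (convex_Icc 0 1)
    · exact fun r hr => (hk r hr).continuousAt.continuousWithinAt
    · intro r hr
      rw [interior_Icc] at hr
      exact (hk r ⟨hr.1.le, hr.2.le⟩).differentiableAt.differentiableWithinAt
    · intro r hr
      rw [interior_Icc] at hr
      have hr' : r ∈ Set.Icc (0 : ℝ) 1 := ⟨hr.1.le, hr.2.le⟩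
      rw [(hk r hr').deriv, ← inner_sub_left]
      have h1 := hl _ (hmem r hr') w hw
      rw [add_sub_cancel_left, norm_smul, Real.norm_of_nonneg hr'.1] at h1
      have h2 := abs_real_inner_le_norm (G (w + r • v) - G w) v
      have h3 := mul_le_mul_of_nonneg_right h1 (norm_nonneg v)
      have h4 := neg_abs_le ⟪G (w + r • v) - G w, v⟫_ℝ
      nlinarith
  have := hmono (Set.left_mem_Icc.2 zero_le_one) (Set.right_mem_Icc.2 zero_le_one) zero_le_one
  simp only [k, hv, zero_smul, add_zero, one_smul, add_sub_cancel] at this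
  rw [← hv] at this
  linarith

/-- A strong monotonicity bound for `G` along the ray from `q` in direction `v` passes to the
derivative. -/
lemma le_inner_fderiv_apply {G : E → E} {q v : E} {c : ℝ} (hG : DifferentiableAt ℝ G q)
    (h : ∀ᶠ s : ℝ in 𝓝[>] 0, c * s ≤ ⟪G (q + s • v) - G q, v⟫_ℝ) :
    c ≤ ⟪fderiv ℝ G q v, v⟫_ℝ := by
  have hd := (hG.hasFDerivAt.hasLineDerivAt v)
  have hs := (HasDerivAt.tendsto_slope_zero_right hd).inner (𝕜 := ℝ)
    (tendsto_const_nhds (x := v))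
  refine ge_of_tendsto hs ?_
  filter_upwards [h, self_mem_nhdsWithin] with s hs (h0 : 0 < s)
  rw [real_inner_smul_left, zero_add, zero_smul, add_zero, le_inv_mul_iff₀ h0]
  linarith

/-- Symmetry of the Hessian at a single point of differentiability of the gradient. -/
lemma inner_hessian_comm [CompleteSpace E] {F : E → ℝ} (hF : Differentiable ℝ F) {p : E}
    (h : DifferentiableAt ℝ (gradient F) p) (u v : E) :
    ⟪hessian F p u, v⟫_ℝ = ⟪u, hessian F p v⟫_ℝ := by
  have h1 : HasFDerivAt (fderiv ℝ F)
      ((isBoundedBilinearMap_inner (𝕜 := ℝ) (E := E)).toContinuousLinearMap ∘L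
        hessian F p) p := by
    have h2 := (isBoundedBilinearMap_inner (𝕜 := ℝ) (E := E)).toContinuousLinearMap.hasFDerivAt.comp
      p h.hasFDerivAt
    convert! h2 using 1
    ext1 q
    exact toDual_gradient.symm
  have h3 := second_derivative_symmetric (fun y => (hF y).hasFDerivAt) h1 u v
  simp only [ContinuousLinearMap.comp_apply] at h3
  rw [real_inner_comm _ u]
  exact h3

/-- A Lipschitz bound on a set bounds the derivative also at the boundary points that are limits
of interior points, if the derivative is continuous within the set. -/
lemma norm_fderiv_le_of_mem_closure_interior {F : Type*} [NormedAddCommGroup F] [NormedSpace ℝ F]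
    {f : E → F} {S : Set E} {l : ℝ≥0} (hf : LipschitzOnWith l f S) {p : E}
    (hc : ContinuousWithinAt (fderiv ℝ f) S p) (hp : p ∈ closure (interior S)) :
    ‖fderiv ℝ f p‖ ≤ l := by
  have : (𝓝[interior S] p).NeBot := mem_closure_iff_nhdsWithin_neBot.1 hp
  refine le_of_tendsto (hc.mono interior_subset).norm ?_
  filter_upwards [self_mem_nhdsWithin] with q hq
  exact norm_fderiv_le_of_lipschitzOn ℝ (mem_interior_iff_mem_nhds.1 hq) hf

/-- First-order Taylor estimate when the derivative is Lipschitz on a set containing the segment.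
The set need not be a neighbourhood of it, which is why differentiability is asked pointwise. -/
lemma norm_sub_sub_fderiv_le {F : Type*} [NormedAddCommGroup F] [NormedSpace ℝ F]
    {f : E → F} {S : Set E} {l : ℝ≥0} (hd : ∀ p ∈ S, DifferentiableAt ℝ f p)
    (hl : LipschitzOnWith l (fderiv ℝ f) S) {p q : E} (hpq : segment ℝ p q ⊆ S) :
    ‖f q - f p - fderiv ℝ f p (q - p)‖ ≤ l * ‖q - p‖ ^ 2 := by
  have := (convex_segment p q).norm_image_sub_le_of_norm_hasFDerivWithin_le' (f := f)
    (φ := fderiv ℝ f p) (C := l * ‖q - p‖)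
    (fun r hr => (hd r (hpq hr)).hasFDerivAt.hasFDerivWithinAt) (fun r hr => ?_)
    (left_mem_segment ℝ p q) (right_mem_segment ℝ p q)
  · rw [pow_two, ← mul_assoc]; exact this
  · refine (hl.norm_sub_le (hpq hr) (hpq (left_mem_segment ℝ p q))).trans ?_
    gcongr
    obtain ⟨a, b, ha, hb, hab, rfl⟩ := hr
    have e : a • p + b • q - p = b • (q - p) := by
      rw [show a = 1 - b by linarith]; module
    rw [e, norm_smul, Real.norm_of_nonneg hb]
    nlinarith [norm_nonneg (q - p)]

lemma exists_inner_eq_of_linearIndependent [FiniteDimensional ℝ E] {ι : Type*} {a : ι → E}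
    (ha : LinearIndependent ℝ a) (b : ι → ℝ) : ∃ d, ∀ i, ⟪a i, d⟫_ℝ = b i := by
  let B := Module.Basis.span ha
  obtain ⟨φ, hφ⟩ := LinearMap.exists_extend (B.constr ℝ b)
  let ψ : StrongDual ℝ E := LinearMap.toContinuousLinearMap φ
  have : CompleteSpace E := FiniteDimensional.complete ℝ E
  refine ⟨(InnerProductSpace.toDual ℝ E).symm ψ, fun i => ?_⟩
  rw [real_inner_comm, InnerProductSpace.toDual_symm_apply]
  have h1 : B.constr ℝ b (B i) = b i := B.constr_basis ℝ b i
  rw [← hφ] at h1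
  have h2 : (B i : E) = a i := congrArg Subtype.val (Module.Basis.span_apply ha i)
  change φ (a i) = b i
  rw [← h2]
  exact h1

end Calculus

/-- Differentiability of a continuous solution branch `z` of `F (x, z x) = 0`, when `F` is only
known to be differentiable at the base point and its partial derivative in `z` is injective.
In contrast to the implicit function theorem, the branch is given. -/
lemma exists_hasFDerivAt_of_eventually_eq_zero {X Z W : Type*}
    [NormedAddCommGroup X] [NormedSpace ℝ X]
    [NormedAddCommGroup Z] [NormedSpace ℝ Z] [NormedAddCommGroup W] [NormedSpace ℝ W]
    [FiniteDimensional ℝ W]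
    {F : X × Z → W} {F' : X × Z →L[ℝ] W} {z : X → Z} {x : X}
    (hF : HasFDerivAt F F' (x, z x)) (hz : ContinuousAt z x)
    (hinj : ∀ v, F' (0, v) = 0 → v = 0) (h0 : ∀ᶠ u in 𝓝 x, F (u, z u) = 0) :
    ∃ D : X →L[ℝ] Z, HasFDerivAt z D x ∧ ∀ ξ, F' (ξ, D ξ) = 0 := by
  let A : Z →L[ℝ] W := F' ∘L ContinuousLinearMap.inr ℝ X Z
  let B : X →L[ℝ] W := F' ∘L ContinuousLinearMap.inl ℝ X Z
  -- a left inverse of the partial derivative solves the linearized equation for `z`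
  obtain ⟨T₀, hT₀⟩ := LinearMap.exists_leftInverse_of_injective (A : Z →ₗ[ℝ] W)
    ((injective_iff_map_eq_zero (A : Z →ₗ[ℝ] W)).2 hinj |> LinearMap.ker_eq_bot.2)
  let T : W →L[ℝ] Z := LinearMap.toContinuousLinearMap T₀
  have hT : ∀ v, T (A v) = v := fun v => LinearMap.congr_fun hT₀ v
  have hx0 : F (x, z x) = 0 := h0.self_of_nhds
  have hsplit : ∀ ξ v, F' (ξ, v) = B ξ + A v := by
    intro ξ v
    have : ((ξ, v) : X × Z) = (ξ, 0) + (0, v) := by simp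
    rw [this, map_add]; rfl
  -- the expansion of `F` along the branch
  have hpair : Tendsto (fun u => (u, z u)) (𝓝 x) (𝓝 (x, z x)) :=
    (continuousAt_id.prodMk hz)
  have ho : (fun u => B (u - x) + A (z u - z x)) =o[𝓝 x] fun u => (u - x, z u - z x) := by
    have h1 := (hF.isLittleO.comp_tendsto hpair).neg_left
    refine h1.congr' ?_ ?_
    · filter_upwards [h0] with u hu
      simp only [Function.comp_apply, hu, hx0, Prod.mk_sub_mk, hsplit]
      abel
    · exact Eventually.of_forall fun u => by simp
  have hTo : (fun u => T (B (u - x)) + (z u - z x)) =o[𝓝 x] fun u => (u - x, z u - z x) := by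
    have h1 := (T.isBigO_comp (fun u => B (u - x) + A (z u - z x)) (𝓝 x)).trans_isLittleO ho
    refine h1.congr_left fun u => ?_
    rw [map_add, hT]
  have hO : (fun u => z u - z x) =O[𝓝 x] fun u => u - x := by
    have h1 : (fun u => T (B (u - x))) =O[𝓝 x] fun u => u - x :=
      ((T ∘L B).isBigO_comp _ _)
    obtain ⟨K, hK⟩ := h1.bound
    have h2 := hTo.def (c := 1 / 2) (by norm_num)
    refine IsBigO.of_bound (2 * K + 1) ?_
    filter_upwards [hK, h2] with u hu1 hu2
    have h3 : ‖z u - z x‖ ≤ ‖T (B (u - x)) + (z u - z x)‖ + ‖T (B (u - x))‖ := by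
      have := norm_sub_le (T (B (u - x)) + (z u - z x)) (T (B (u - x)))
      rwa [add_sub_cancel_left] at this
    have h4 : ‖((u - x, z u - z x) : X × Z)‖ ≤ ‖u - x‖ + ‖z u - z x‖ := by
      rw [Prod.norm_def]; exact max_le_add_of_nonneg (norm_nonneg _) (norm_nonneg _)
    linarith
  have hD : HasFDerivAt z (-(T ∘L B)) x := by
    refine HasFDerivAt.of_isLittleO ?_
    have h1 : (fun u => ((u - x, z u - z x) : X × Z)) =O[𝓝 x] fun u => u - x :=
      (isBigO_refl _ _).prod_left hO
    refine (hTo.trans_isBigO h1).congr_left fun u => ?_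
    simp; abel
  refine ⟨_, hD, fun ξ => ?_⟩
  have hcomp : HasFDerivAt (fun u => F (u, z u))
      (F' ∘L (ContinuousLinearMap.id ℝ X).prod (-(T ∘L B))) x :=
    hF.comp x ((hasFDerivAt_id x).prodMk hD)
  have hzero : HasFDerivAt (fun u => F (u, z u)) (0 : X →L[ℝ] W) x :=
    (hasFDerivAt_const (0 : W) x).congr_of_eventuallyEq h0
  exact congrArg (fun L : X →L[ℝ] W => L ξ) (hcomp.unique hzero)

/-- If all the nonzero singular values of a surjective `T` are at least `s`, then its adjoint
expands norms by at least `s`. -/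
lemma mul_norm_le_norm_adjoint {E F : Type*} [NormedAddCommGroup E] [InnerProductSpace ℝ E]
    [FiniteDimensional ℝ E] [NormedAddCommGroup F] [InnerProductSpace ℝ F] [FiniteDimensional ℝ F]
    (T : E →ₗ[ℝ] F) (hT : Function.Surjective T) {s : ℝ} (hs : 0 ≤ s)
    (h : ∀ k < Module.finrank ℝ F, s ≤ T.singularValues k) (v : F) :
    s * ‖v‖ ≤ ‖LinearMap.adjoint T v‖ := by
  obtain ⟨w, rfl⟩ := hT v
  set n := Module.finrank ℝ E with hn
  have hsym := T.isSymmetric_adjoint_comp_self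
  let b := hsym.eigenvectorBasis rfl
  let σ : Fin n → ℝ := fun i => T.singularValues i ^ 2
  have heig : ∀ i, LinearMap.adjoint T (T (b i)) = σ i • b i := by
    intro i
    have := hsym.apply_eigenvectorBasis rfl i
    rw [← T.sq_singularValues_fin rfl i] at this
    exact this
  have hcoef : ∀ i, ⟪b i, LinearMap.adjoint T (T w)⟫_ℝ = σ i * ⟪b i, w⟫_ℝ := by
    intro i
    rw [LinearMap.adjoint_inner_right, ← LinearMap.adjoint_inner_left, heig,
      real_inner_smul_left]
  have h1 : ‖LinearMap.adjoint T (T w)‖ ^ 2 = ∑ i, (σ i * ⟪b i, w⟫_ℝ) ^ 2 := by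
    rw [← b.sum_sq_norm_inner_right]
    exact Finset.sum_congr rfl fun i _ => by rw [hcoef, Real.norm_eq_abs, sq_abs]
  have h2 : ‖T w‖ ^ 2 = ∑ i, σ i * ⟪b i, w⟫_ℝ ^ 2 := by
    rw [← real_inner_self_eq_norm_sq, ← LinearMap.adjoint_inner_right, ← b.sum_inner_mul_inner]
    refine Finset.sum_congr rfl fun i _ => ?_
    rw [hcoef, real_inner_comm]; ring
  refine abs_le_of_sq_le_sq' ?_ (norm_nonneg _) |>.2
  rw [mul_pow, h1, h2, Finset.mul_sum]
  refine Finset.sum_le_sum fun i _ => ?_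
  have hσ : σ i = 0 ∨ s ^ 2 ≤ σ i := by
    by_cases hi : (i : ℕ) < Module.finrank ℝ F
    · right; exact pow_le_pow_left₀ hs (h i hi) 2
    · left
      have : T.singularValues i = 0 :=
        T.singularValues_eq_zero_iff_le_finrank_range.2
          ((Submodule.finrank_le _).trans (not_lt.1 hi))
      simp [σ, this]
  have hnn : 0 ≤ σ i := sq_nonneg _
  rcases hσ with h0 | h0
  · simp [h0]
  · have := mul_le_mul_of_nonneg_right h0 (mul_nonneg hnn (sq_nonneg ⟪b i, w⟫_ℝ))
    nlinarith

/-! ### The joint space -/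

/-- The point `(x, y)` of the joint space. -/
def pt {dx dy : ℕ} (x : Vec dx) (y : Vec dy) : Joint dx dy := WithLp.toLp 2 (x, y)

section JointSpace

variable {dx dy : ℕ}

lemma inner_joint (p q : Joint dx dy) : ⟪p, q⟫_ℝ = ⟪p.fst, q.fst⟫_ℝ + ⟪p.snd, q.snd⟫_ℝ :=
  WithLp.prod_inner_apply p q

@[simp] lemma inner_pt (p : Joint dx dy) (u : Vec dx) (v : Vec dy) :
    ⟪p, pt u v⟫_ℝ = ⟪p.fst, u⟫_ℝ + ⟪p.snd, v⟫_ℝ := inner_joint p _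

lemma pt_sub (x x' : Vec dx) (y y' : Vec dy) : pt x y - pt x' y' = pt (x - x') (y - y') := rfl

lemma pt_add (x x' : Vec dx) (y y' : Vec dy) : pt x y + pt x' y' = pt (x + x') (y + y') := rfl

lemma smul_pt (r : ℝ) (x : Vec dx) (y : Vec dy) : r • pt x y = pt (r • x) (r • y) := rfl

lemma pt_add_smul (x : Vec dx) (y v : Vec dy) (s : ℝ) :
    pt x y + s • pt 0 v = pt x (y + s • v) := by
  rw [smul_pt, pt_add, smul_zero, add_zero]

lemma norm_pt_sq (x : Vec dx) (y : Vec dy) : ‖pt x y‖ ^ 2 = ‖x‖ ^ 2 + ‖y‖ ^ 2 :=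
  WithLp.prod_norm_sq_eq_of_L2 _

lemma norm_pt_zero (y : Vec dy) : ‖pt (0 : Vec dx) y‖ = ‖y‖ := by
  have := norm_pt_sq (0 : Vec dx) y
  rw [norm_zero, zero_pow two_ne_zero, zero_add] at this
  exact (pow_left_inj₀ (norm_nonneg _) (norm_nonneg _) two_ne_zero).1 this

lemma norm_pt_le (x : Vec dx) (y : Vec dy) : ‖pt x y‖ ≤ ‖x‖ + ‖y‖ := by
  refine abs_le_of_sq_le_sq' ?_ (by positivity) |>.2
  rw [norm_pt_sq]
  nlinarith [norm_nonneg x, norm_nonneg y]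

lemma norm_snd_le (p : Joint dx dy) : ‖p.snd‖ ≤ ‖p‖ := by
  refine abs_le_of_sq_le_sq' ?_ (by positivity) |>.2
  rw [WithLp.prod_norm_sq_eq_of_L2]
  nlinarith [norm_nonneg p.fst]

/-- `(x, y) ↦ pt x y` as a continuous linear map. -/
def ptL : Vec dx × Vec dy →L[ℝ] Joint dx dy :=
  (WithLp.prodContinuousLinearEquiv 2 ℝ (Vec dx) (Vec dy)).symm

/-- The second component as a continuous linear map on the joint space. -/
def sndL : Joint dx dy →L[ℝ] Vec dy :=
  ContinuousLinearMap.snd ℝ (Vec dx) (Vec dy) ∘L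
    (WithLp.prodContinuousLinearEquiv 2 ℝ (Vec dx) (Vec dy) : Joint dx dy →L[ℝ] Vec dx × Vec dy)

@[simp] lemma sndL_apply (p : Joint dx dy) : sndL p = p.snd := rfl

lemma continuous_pt : Continuous fun q : Vec dx × Vec dy => pt q.1 q.2 :=
  (ptL (dx := dx) (dy := dy)).continuous

lemma tendsto_pt {α : Type*} {l : Filter α} {a : α → Vec dx} {b : α → Vec dy} {x : Vec dx}
    {y : Vec dy} (ha : Tendsto a l (𝓝 x)) (hb : Tendsto b l (𝓝 y)) :
    Tendsto (fun r => pt (a r) (b r)) l (𝓝 (pt x y)) :=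
  (continuous_pt.tendsto (x, y)).comp (ha.prodMk_nhds hb)

lemma hasGradientAt_of_joint {F : Vec dx → Vec dy → ℝ} (hF : Differentiable ℝ (joint F))
    (x : Vec dx) (y : Vec dy) :
    HasGradientAt (F x) (gradient (joint F) (pt x y)).snd y := by
  have h1 : HasFDerivAt (fun v : Vec dy => ptL (x, v))
      (ptL ∘L ContinuousLinearMap.inr ℝ (Vec dx) (Vec dy)) y :=
    ptL.hasFDerivAt.comp y (hasFDerivAt_prodMk_right x y)
  have h2 := ((hF (pt x y)).hasGradientAt.hasFDerivAt).comp y h1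
  rw [hasGradientAt_iff_hasFDerivAt]
  convert! h2 using 1
  ext1 v
  change _ = ⟪gradient (joint F) (pt x y), pt 0 v⟫_ℝ
  rw [inner_pt, inner_zero_right, zero_add, InnerProductSpace.toDual_apply_apply]

lemma gradient_eq_snd {F : Vec dx → Vec dy → ℝ} (hF : Differentiable ℝ (joint F))
    (x : Vec dx) (y : Vec dy) :
    gradient (F x) y = (gradient (joint F) (pt x y)).snd :=
  (hasGradientAt_of_joint hF x y).gradient

lemma continuous_gradient {E : Type*} [NormedAddCommGroup E] [InnerProductSpace ℝ E]
    [CompleteSpace E] {F : E → ℝ} (hF : ContDiff ℝ 1 F) : Continuous (gradient F) :=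
  (InnerProductSpace.toDual ℝ E).symm.continuous.comp (hF.continuous_fderiv one_ne_zero)

end JointSpace

/-! ### Parametric programs and the Karush-Kuhn-Tucker conditions -/

namespace Problem

variable {dx dy m : ℕ} (P : Problem dx dy m)

@[simp] lemma pt_mem_domain {x : Vec dx} {y : Vec dy} : pt x y ∈ P.domain ↔ y ∈ P.feasible x :=
  Iff.rfl

@[simp] lemma mem_activeSet {x : Vec dx} {y : Vec dy} {i : Fin m} :
    i ∈ P.activeSet x y ↔ P.h i x y = 0 := by
  simp [activeSet]

/-- The Karush-Kuhn-Tucker conditions for minimizing `ψ x` over `P.feasible x`. For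
`ψ = P.gPen t` this is, by definition, `P.IsMultiplier t`. -/
def IsKKT (ψ : Vec dx → Vec dy → ℝ) (x : Vec dx) (y : Vec dy) (lam : Vec m) : Prop :=
  (∀ i, 0 ≤ lam i) ∧ (∀ i, lam i * P.h i x y = 0) ∧
    gradient (ψ x) y + ∑ i, lam i • gradient (P.h i x) y = 0

/-- The gradient, in both variables, of the Lagrangian `ψ + ∑ i, lam i * h i`. -/
def lagGrad (ψ : Vec dx → Vec dy → ℝ) (lam : Vec m) (p : Joint dx dy) : Joint dx dy :=
  gradient (joint ψ) p + ∑ i, lam i • gradient (joint (P.h i)) p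

/-- The Hessian, in both variables, of the Lagrangian `ψ + ∑ i, lam i * h i`. -/
def lagHess (ψ : Vec dx → Vec dy → ℝ) (lam : Vec m) (p : Joint dx dy) :
    Joint dx dy →L[ℝ] Joint dx dy :=
  hessian (joint ψ) p + ∑ i, lam i • hessian (joint (P.h i)) p

/-- The family of programs `min ψ x` over `P.feasible x`, with the regularity in force here:
all data are `C¹` with gradients differentiable on the domain and Hessians continuous there, the
constraints are convex in `y`, and `ψ` satisfies the first-order inequality of `ν`-strong
convexity in `y`. -/
structure IsProgram (ψ : Vec dx → Vec dy → ℝ) (ν : ℝ) : Prop where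
  contDiff_obj : ContDiff ℝ 1 (joint ψ)
  contDiff_h : ∀ i, ContDiff ℝ 1 (joint (P.h i))
  diff_obj : ∀ p ∈ P.domain, DifferentiableAt ℝ (gradient (joint ψ)) p
  diff_h : ∀ i, ∀ p ∈ P.domain, DifferentiableAt ℝ (gradient (joint (P.h i))) p
  cont_obj : ContinuousOn (hessian (joint ψ)) P.domain
  convex_h : ∀ i x, ConvexOn ℝ Set.univ (P.h i x)
  growth : ∀ x, ∀ w ∈ P.feasible x, ∀ y ∈ P.feasible x,
    ψ x w + ⟪gradient (ψ x) w, y - w⟫_ℝ + ν / 2 * ‖y - w‖ ^ 2 ≤ ψ x y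

variable {P}

/-- Directions along which the active constraints have prescribed first-order behaviour. -/
lemma LICQ.exists_inner_eq {x : Vec dx} {y : Vec dy} (hL : P.LICQ x y) (b : Fin m → ℝ) :
    ∃ d, ∀ i ∈ P.activeSet x y, ⟪gradient (P.h i x) y, d⟫_ℝ = b i := by
  obtain ⟨d, hd⟩ := exists_inner_eq_of_linearIndependent hL fun i => b i
  exact ⟨d, fun i hi => hd ⟨i, hi⟩⟩

lemma eventually_neg_of_inner_neg (hP : ∀ i, ContDiff ℝ 1 (joint (P.h i)))
    {x : Vec dx} {y d : Vec dy} (hy : y ∈ P.feasible x)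
    (hd : ∀ i ∈ P.activeSet x y, ⟪gradient (P.h i x) y, d⟫_ℝ < 0) :
    ∀ᶠ s : ℝ in 𝓝[>] 0, ∀ i, P.h i x (y + s • d) < 0 := by
  rw [eventually_all]
  intro i
  have hG : HasGradientAt (P.h i x) (gradient (P.h i x) y) y :=
    (hasGradientAt_of_joint ((hP i).differentiable one_ne_zero) x y).differentiableAt.hasGradientAt
  have hline := hasDerivAt_line_of_hasGradientAt (w := y) (s := 0) d (by simpa using hG)
  by_cases hi : i ∈ P.activeSet x y
  · have hs := hline.tendsto_slope_zero_right
    filter_upwards [hs.eventually_lt_const (hd i hi), self_mem_nhdsWithin] with s hs (h0 : 0 < s)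
    simp only [zero_add, zero_smul, add_zero, (P.mem_activeSet).1 hi, sub_zero, smul_eq_mul] at hs
    by_contra hcon
    exact absurd hs (not_lt.2 (mul_nonneg (inv_nonneg.2 h0.le) (not_lt.1 hcon)))
  · have hlt : P.h i x (y + (0 : ℝ) • d) < 0 := by
      rw [zero_smul, add_zero]
      exact lt_of_le_of_ne (hy i) fun h => hi ((P.mem_activeSet).2 h)
    exact (hline.continuousAt.tendsto.mono_left nhdsWithin_le_nhds).eventually_lt_const hlt

lemma mem_interior_domain (hP : ∀ i, ContDiff ℝ 1 (joint (P.h i)))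
    {p : Joint dx dy} (hp : ∀ i, P.h i p.fst p.snd < 0) :
    p ∈ interior P.domain := by
  have ho : IsOpen {q : Joint dx dy | ∀ i, joint (P.h i) q < 0} := by
    simp only [Set.ofPred_forall]
    exact isOpen_iInter_of_finite fun i => isOpen_lt (hP i).continuous continuous_const
  exact interior_maximal (fun q hq i => (hq i).le) ho hp

/-- Moving along a Slater direction, a feasible point is approached vertically from the interior
of the domain. -/
lemma LICQ.exists_eventually_mem_interior (hP : ∀ i, ContDiff ℝ 1 (joint (P.h i)))
    {x : Vec dx} {y : Vec dy} (hL : P.LICQ x y)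
    (hy : y ∈ P.feasible x) :
    ∃ d : Vec dy, ∀ᶠ s : ℝ in 𝓝[>] 0, pt x (y + s • d) ∈ interior P.domain := by
  obtain ⟨d, hd⟩ := hL.exists_inner_eq fun _ => -1
  refine ⟨d, ?_⟩
  filter_upwards [eventually_neg_of_inner_neg hP hy fun i hi => by rw [hd i hi]; norm_num]
    with s hs
  exact mem_interior_domain hP hs

lemma LICQ.mem_closure_interior (hP : ∀ i, ContDiff ℝ 1 (joint (P.h i)))
    {x : Vec dx} {y : Vec dy} (hL : P.LICQ x y)
    (hy : y ∈ P.feasible x) : pt x y ∈ closure (interior P.domain) := by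
  obtain ⟨d, hd⟩ := hL.exists_eventually_mem_interior hP hy
  have ht : Tendsto (fun s : ℝ => pt x (y + s • d)) (𝓝[>] 0) (𝓝 (pt x y)) := by
    have : Continuous fun s : ℝ => pt x (y + s • d) :=
      continuous_pt.comp (by fun_prop : Continuous fun s : ℝ => (x, y + s • d))
    simpa using (this.tendsto 0).mono_left nhdsWithin_le_nhds
  exact mem_closure_of_tendsto ht hd

/-- Under linear independence of the active gradients, a minimizer satisfies the
Karush-Kuhn-Tucker conditions. -/
lemma LICQ.exists_isKKT (hP : ∀ i, ContDiff ℝ 1 (joint (P.h i)))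
    {ψ : Vec dx → Vec dy → ℝ} (hψ : ContDiff ℝ 1 (joint ψ))
    {x : Vec dx} {y : Vec dy} (hL : P.LICQ x y)
    (hy : y ∈ P.feasible x) (hmin : IsMinOn (ψ x) (P.feasible x) y) :
    ∃ lam : Vec m, P.IsKKT ψ x y lam := by
  classical
  set I := P.activeSet x y with hI
  set a : Fin m → Vec dy := fun i => gradient (P.h i x) y with ha
  set G := gradient (ψ x) y with hG
  have hGat : HasGradientAt (ψ x) G y :=
    (hasGradientAt_of_joint (hψ.differentiable one_ne_zero) x y).differentiableAt.hasGradientAt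
  -- first-order optimality in directions that strictly decrease the active constraints
  have h1 : ∀ d, (∀ i ∈ I, ⟪a i, d⟫_ℝ < 0) → 0 ≤ ⟪G, d⟫_ℝ := by
    intro d hd
    have hline := hasDerivAt_line_of_hasGradientAt (w := y) (s := 0) d (by simpa using hGat)
    refine ge_of_tendsto hline.tendsto_slope_zero_right ?_
    filter_upwards [eventually_neg_of_inner_neg hP hy hd, self_mem_nhdsWithin] with s hs h0
    simp only [zero_add, zero_smul, add_zero, smul_eq_mul]
    refine mul_nonneg (inv_nonneg.2 (le_of_lt h0)) (sub_nonneg.2 ?_)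
    exact hmin (show y + s • d ∈ P.feasible x from fun i => (hs i).le)
  have h2 : ∀ d, (∀ i ∈ I, ⟪a i, d⟫_ℝ ≤ 0) → 0 ≤ ⟪G, d⟫_ℝ := by
    intro d hd
    obtain ⟨e, he⟩ := hL.exists_inner_eq fun _ => -1
    have ht : Tendsto (fun s : ℝ => ⟪G, d + s • e⟫_ℝ) (𝓝[>] 0) (𝓝 ⟪G, d⟫_ℝ) := by
      have : Continuous fun s : ℝ => ⟪G, d + s • e⟫_ℝ := by fun_prop
      simpa using (this.tendsto 0).mono_left nhdsWithin_le_nhds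
    refine ge_of_tendsto ht ?_
    filter_upwards [self_mem_nhdsWithin] with s (hs : 0 < s)
    refine h1 _ fun i hi => ?_
    rw [inner_add_right, real_inner_smul_right, he i hi]
    linarith [hd i hi]
  -- decompose `-G` along the span of the active gradients and its orthogonal complement
  set V : Submodule ℝ (Vec dy) := Submodule.span ℝ (Set.range fun i : I => a i) with hV
  obtain ⟨v, hv, r, hr, hvr⟩ := V.exists_add_mem_mem_orthogonal (-G)
  have har : ∀ i ∈ I, ⟪a i, r⟫_ℝ = 0 := fun i hi =>
    hr (a i) (Submodule.subset_span ⟨⟨i, hi⟩, rfl⟩)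
  have hr0 : r = 0 := by
    have h3 := h2 r fun i hi => (har i hi).le
    have h4 : ⟪G, r⟫_ℝ = -‖r‖ ^ 2 := by
      rw [← neg_neg G, hvr, inner_neg_left, inner_add_left, hr v hv, zero_add,
        real_inner_self_eq_norm_sq]
    have : ‖r‖ ^ 2 ≤ 0 := by linarith
    exact norm_eq_zero.1 (pow_eq_zero_iff two_ne_zero |>.1 (le_antisymm this (sq_nonneg _)))
  obtain ⟨c, hc⟩ := (Submodule.mem_span_range_iff_exists_fun ℝ).1 hv
  let l : Fin m → ℝ := fun i => if hi : i ∈ I then c ⟨i, hi⟩ else 0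
  have hsum : ∑ i, l i • a i = -G := by
    rw [hvr, hr0, add_zero, ← hc]
    rw [← Finset.sum_subset (Finset.subset_univ I) fun i _ hi => by simp [l, hi],
      ← Finset.sum_coe_sort I]
    exact Finset.sum_congr rfl fun i _ => by simp [l]
  have hnn : ∀ i, 0 ≤ l i := by
    intro i
    by_cases hi : i ∈ I
    · obtain ⟨e, he⟩ := hL.exists_inner_eq fun j => if j = i then -1 else 0
      have h5 := h2 e fun j hj => by
        rw [he j hj]; split_ifs <;> norm_num
      have h6 : ⟪G, e⟫_ℝ = l i := by
        rw [← neg_neg G, ← hsum, inner_neg_left, sum_inner, Finset.sum_eq_single i]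
        · rw [real_inner_smul_left, he i hi]; simp
        · intro j _ hji
          by_cases hj : j ∈ I
          · rw [real_inner_smul_left, he j hj, if_neg hji, mul_zero]
          · simp [l, hj]
        · simp
      rwa [h6] at h5
    · simp [l, hi]
  refine ⟨WithLp.toLp 2 l, hnn, fun i => ?_, ?_⟩
  · by_cases hi : i ∈ I
    · rw [(P.mem_activeSet).1 hi, mul_zero]
    · simp [l, hi]
  · change G + ∑ i, l i • a i = 0
    rw [hsum, add_neg_cancel]

/-! ### Stability of the minimizer and of the multiplier -/

lemma IsProgram.lagGrad_snd {ψ : Vec dx → Vec dy → ℝ} {ν : ℝ} (hP : P.IsProgram ψ ν) (lam : Vec m)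
    (u : Vec dx) (w : Vec dy) :
    (P.lagGrad ψ lam (pt u w)).snd =
      gradient (ψ u) w + ∑ i, lam i • gradient (P.h i u) w := by
  rw [gradient_eq_snd (hP.contDiff_obj.differentiable one_ne_zero)]
  simp_rw [gradient_eq_snd ((hP.contDiff_h _).differentiable one_ne_zero)]
  simp only [lagGrad, ← sndL_apply, map_add, map_sum, map_smul]

lemma IsProgram.continuous_lagGrad {ψ : Vec dx → Vec dy → ℝ} {ν : ℝ} (hP : P.IsProgram ψ ν)
    (lam : Vec m) : Continuous (P.lagGrad ψ lam) :=
  (continuous_gradient hP.contDiff_obj).add <| continuous_finsetSum _ fun i _ =>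
    (continuous_gradient (hP.contDiff_h i)).const_smul (lam i)

/-- A quantitative form of the fact that a point at which the Karush-Kuhn-Tucker conditions hold
approximately, with a nonnegative multiplier, is close to the minimizer. -/
lemma IsProgram.norm_sub_sq_le {ψ : Vec dx → Vec dy → ℝ} {ν : ℝ} (hP : P.IsProgram ψ ν)
    (hν : 0 < ν) {u : Vec dx} {w y : Vec dy} (hw : w ∈ P.feasible u) (hy : y ∈ P.feasible u)
    (hle : ψ u y ≤ ψ u w) {lam : Vec m} (hlam : ∀ i, 0 ≤ lam i) :
    ν / 4 * ‖y - w‖ ^ 2 ≤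
      ‖(P.lagGrad ψ lam (pt u w)).snd‖ ^ 2 / ν - ∑ i, lam i * P.h i u w := by
  have h1 := hP.growth u w hw y hy
  set ρ := (P.lagGrad ψ lam (pt u w)).snd with hρ
  have hG : gradient (ψ u) w = ρ - ∑ i, lam i • gradient (P.h i u) w := by
    rw [hρ, hP.lagGrad_snd, add_sub_cancel_right]
  have h2 : ∑ i, lam i * ⟪gradient (P.h i u) w, y - w⟫_ℝ ≤ -∑ i, lam i * P.h i u w := by
    rw [← Finset.sum_neg_distrib]
    refine Finset.sum_le_sum fun i _ => ?_
    rw [← mul_neg]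
    refine mul_le_mul_of_nonneg_left ?_ (hlam i)
    have hc := add_inner_add_le_of_strongConvexOn
      (strongConvexOn_zero.2 (hP.convex_h i u)) (Set.mem_univ w) (Set.mem_univ y)
      (hasGradientAt_of_joint ((hP.contDiff_h i).differentiable one_ne_zero) u w)
    rw [← gradient_eq_snd ((hP.contDiff_h i).differentiable one_ne_zero)] at hc
    linarith [hy i]
  have h3 : ⟪gradient (ψ u) w, y - w⟫_ℝ =
      ⟪ρ, y - w⟫_ℝ - ∑ i, lam i * ⟪gradient (P.h i u) w, y - w⟫_ℝ := by
    simp only [hG, inner_sub_left ρ, sum_inner, real_inner_smul_left]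
  have h4 : -(‖ρ‖ * ‖y - w‖) ≤ ⟪ρ, y - w⟫_ℝ :=
    (abs_le.1 (abs_real_inner_le_norm ρ (y - w))).1
  have h5 : ‖ρ‖ * ‖y - w‖ ≤ ‖ρ‖ ^ 2 / ν + ν / 4 * ‖y - w‖ ^ 2 := by
    have : ‖ρ‖ ^ 2 / ν + ν / 4 * ‖y - w‖ ^ 2 - ‖ρ‖ * ‖y - w‖ =
        (‖ρ‖ - ν / 2 * ‖y - w‖) ^ 2 / ν := by field_simp; ring
    have h6 : 0 ≤ (‖ρ‖ - ν / 2 * ‖y - w‖) ^ 2 / ν := by positivity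
    linarith
  linarith

/-- The stability estimate is applied with the multiplier at `x` and with a point `Y x + s • d`,
`d` a Slater direction, which is strictly feasible at `x` and so remains feasible near `x`. -/
lemma IsProgram.continuousAt_minimizer {ψ : Vec dx → Vec dy → ℝ} {ν : ℝ} (hP : P.IsProgram ψ ν)
    (hν : 0 < ν) {Y : Vec dx → Vec dy} (hY : ∀ u, Y u ∈ P.feasible u)
    (hmin : ∀ u, IsMinOn (ψ u) (P.feasible u) (Y u)) {x : Vec dx} (hL : P.LICQ x (Y x)) :
    ContinuousAt Y x := by
  obtain ⟨lam, hlam⟩ := hL.exists_isKKT hP.contDiff_h hP.contDiff_obj (hY x) (hmin x)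
  obtain ⟨d, hd⟩ := hL.exists_eventually_mem_interior hP.contDiff_h (hY x)
  let R : Joint dx dy → ℝ := fun q =>
    ‖(P.lagGrad ψ lam q).snd‖ ^ 2 / ν - ∑ i, lam i * joint (P.h i) q
  have hRc : Continuous R := by
    have h1 : Continuous fun q => (P.lagGrad ψ lam q).snd :=
      (sndL (dx := dx) (dy := dy)).continuous.comp (hP.continuous_lagGrad lam)
    have h2 : ∀ i, Continuous (joint (P.h i)) := fun i => (hP.contDiff_h i).continuous
    fun_prop
  have hR0 : R (pt x (Y x)) = 0 := by
    have h1 : (P.lagGrad ψ lam (pt x (Y x))).snd = 0 := by rw [hP.lagGrad_snd]; exact hlam.2.2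
    have h2 : ∑ i, lam i * joint (P.h i) (pt x (Y x)) = 0 :=
      Finset.sum_eq_zero fun i _ => hlam.2.1 i
    change ‖(P.lagGrad ψ lam (pt x (Y x))).snd‖ ^ 2 / ν -
      ∑ i, lam i * joint (P.h i) (pt x (Y x)) = 0
    rw [h1, h2]; simp
  rw [Metric.continuousAt_iff']
  intro ε hε
  -- a fixed point near `Y x` that is feasible for all parameters close to `x`
  have hN : IsOpen ({q : Joint dx dy | R q < ν / 4 * (ε / 2) ^ 2} ∩ interior P.domain) :=
    (isOpen_lt hRc continuous_const).inter isOpen_interior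
  have hcurve : Continuous fun s : ℝ => pt x (Y x + s • d) :=
    continuous_pt.comp (by fun_prop : Continuous fun s : ℝ => (x, Y x + s • d))
  have e1 : ∀ᶠ s : ℝ in 𝓝[>] 0, R (pt x (Y x + s • d)) < ν / 4 * (ε / 2) ^ 2 := by
    have := ((hRc.comp hcurve).tendsto 0).mono_left (nhdsWithin_le_nhds (s := Set.Ioi 0))
    refine this.eventually_lt_const ?_
    simp only [Function.comp_apply, zero_smul, add_zero, hR0]
    positivity
  have e2 : ∀ᶠ s : ℝ in 𝓝[>] 0, ‖s • d‖ < ε / 2 := by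
    have h1 : Continuous fun s : ℝ => ‖s • d‖ := by fun_prop
    refine ((h1.tendsto 0).mono_left nhdsWithin_le_nhds).eventually_lt_const ?_
    simpa using half_pos hε
  obtain ⟨s, hs1, hs2, hs3⟩ := (e1.and (e2.and hd)).exists
  have hcx : Tendsto (fun u => pt u (Y x + s • d)) (𝓝 x) (𝓝 (pt x (Y x + s • d))) :=
    tendsto_pt tendsto_id tendsto_const_nhds
  filter_upwards [hcx.eventually (hN.mem_nhds ⟨hs1, hs3⟩)] with u hu
  have hw : Y x + s • d ∈ P.feasible u :=
    P.pt_mem_domain.1 (interior_subset hu.2)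
  have h1 := hP.norm_sub_sq_le hν hw (hY u) (hmin u hw) hlam.1
  have h2 : ν / 4 * ‖Y u - (Y x + s • d)‖ ^ 2 < ν / 4 * (ε / 2) ^ 2 := h1.trans_lt hu.1
  have h3 : ‖Y u - (Y x + s • d)‖ < ε / 2 :=
    lt_of_pow_lt_pow_left₀ 2 (by positivity) (lt_of_mul_lt_mul_left h2 (by positivity))
  calc dist (Y u) (Y x) = ‖(Y u - (Y x + s • d)) + s • d‖ := by rw [dist_eq_norm]; congr 1; abel
    _ ≤ ‖Y u - (Y x + s • d)‖ + ‖s • d‖ := norm_add_le _ _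
    _ < ε := by linarith

lemma abs_coord_le {n : ℕ} (v : Vec n) (i : Fin n) : |v i| ≤ ‖v‖ := by
  simpa using PiLp.norm_apply_le v i

lemma norm_sum_smul_le {n : ℕ} {E : Type*} [NormedAddCommGroup E] [NormedSpace ℝ E] (v : Vec n)
    (a : Fin n → E) : ‖∑ i, v i • a i‖ ≤ ‖v‖ * ∑ i, ‖a i‖ := by
  rw [Finset.mul_sum]
  refine (norm_sum_le _ _).trans (Finset.sum_le_sum fun i _ => ?_)
  rw [norm_smul, Real.norm_eq_abs]
  gcongr
  exact abs_coord_le v i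

lemma IsKKT.eq_zero_of_notMem {ψ : Vec dx → Vec dy → ℝ} {x : Vec dx} {y : Vec dy} {lam : Vec m}
    (h : P.IsKKT ψ x y lam) {i : Fin m} (hi : i ∉ P.activeSet x y) : lam i = 0 :=
  (mul_eq_zero.1 (h.2.1 i)).resolve_right fun h0 => hi (P.mem_activeSet.2 h0)

/-- The linear combinations of the active gradients in `y` are bounded below by `s` times the norm
of the coefficients. The coefficient vectors have all `m` entries and vanish at inactive indices,
so that no vectors indexed by the active set occur. -/
def JacobianLower (P : Problem dx dy m) (s : ℝ) (x : Vec dx) (y : Vec dy) : Prop :=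
  ∀ v : Vec m, (∀ i ∉ P.activeSet x y, v i = 0) →
    s * ‖v‖ ≤ ‖∑ i, v i • gradient (P.h i x) y‖

lemma IsProgram.eventually_activeSet_subset {ψ : Vec dx → Vec dy → ℝ} {ν : ℝ}
    (hP : P.IsProgram ψ ν)
    {Y : Vec dx → Vec dy} {x : Vec dx} (hc : ContinuousAt Y x) :
    ∀ᶠ u in 𝓝 x, P.activeSet u (Y u) ⊆ P.activeSet x (Y x) := by
  have h1 : ∀ᶠ u in 𝓝 x, ∀ i, P.h i x (Y x) ≠ 0 → P.h i u (Y u) ≠ 0 := by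
    rw [eventually_all]
    intro i
    by_cases hi : P.h i x (Y x) = 0
    · simp [hi]
    · have := ((hP.contDiff_h i).continuous.tendsto (pt x (Y x))).comp
        (tendsto_pt tendsto_id hc.tendsto)
      filter_upwards [this.eventually_ne hi] with u hu _ using hu
  filter_upwards [h1] with u hu i hi
  rw [mem_activeSet] at hi ⊢
  by_contra hcon
  exact hu i hcon hi

lemma IsProgram.eventually_LICQ {ψ : Vec dx → Vec dy → ℝ} {ν : ℝ} (hP : P.IsProgram ψ ν)
    {Y : Vec dx → Vec dy} {x : Vec dx} (hc : ContinuousAt Y x) (hL : P.LICQ x (Y x)) :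
    ∀ᶠ u in 𝓝 x, P.LICQ u (Y u) := by
  let a : Vec dx → P.activeSet x (Y x) → Vec dy := fun u i => gradient (P.h i u) (Y u)
  have ha : ContinuousAt a x := by
    refine continuousAt_pi.2 fun i => ?_
    have h1 : (fun u => a u i) = fun u => sndL (gradient (joint (P.h i)) (pt u (Y u))) := by
      funext u
      exact gradient_eq_snd ((hP.contDiff_h i).differentiable one_ne_zero) _ _
    rw [h1]
    exact (sndL.continuous.tendsto _).comp
      (((continuous_gradient (hP.contDiff_h i)).tendsto _).comp (tendsto_pt tendsto_id hc.tendsto))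
  have ho := ha.eventually (isOpen_setOfPred_linearIndependent.mem_nhds (x := a x) hL)
  filter_upwards [ho, hP.eventually_activeSet_subset hc] with u hu hsub
  let ι : P.activeSet u (Y u) → P.activeSet x (Y x) := fun i => ⟨i.1, hsub i.2⟩
  have hι : Function.Injective ι := fun i j hij =>
    Subtype.ext (congrArg (fun k : P.activeSet x (Y x) => k.1) hij)
  have hu' : LinearIndependent ℝ (a u) := hu
  exact hu'.comp ι hι

/-- Multipliers are unique and depend continuously on the parameter: both follow from the lower
bound on combinations of the active gradients, applied to the difference of two multipliers. -/
lemma IsProgram.tendsto_multiplier {ψ : Vec dx → Vec dy → ℝ} {ν : ℝ} (hP : P.IsProgram ψ ν)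
    {Y : Vec dx → Vec dy} {x : Vec dx} (hc : ContinuousAt Y x) {s : ℝ} (hs : 0 < s)
    (hJ : P.JacobianLower s x (Y x)) {lam : Vec m} (hlam : P.IsKKT ψ x (Y x) lam)
    {l : Vec dx → Vec m} (hl : ∀ᶠ u in 𝓝 x, P.IsKKT ψ u (Y u) (l u)) :
    Tendsto l (𝓝 x) (𝓝 lam) := by
  have hpt : Tendsto (fun u => pt u (Y u)) (𝓝 x) (𝓝 (pt x (Y x))) :=
    tendsto_pt tendsto_id hc.tendsto
  let a : Fin m → Vec dx → Vec dy := fun i u => gradient (P.h i u) (Y u)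
  let r : Vec dx → Vec dy := fun u => (P.lagGrad ψ lam (pt u (Y u))).snd
  let e : Vec dx → ℝ := fun u => ∑ i, ‖a i u - a i x‖
  have hr : Tendsto r (𝓝 x) (𝓝 0) := by
    have h1 : r x = 0 := (hP.lagGrad_snd lam x (Y x)).trans hlam.2.2
    rw [← h1]
    exact (sndL.continuous.tendsto _).comp (((hP.continuous_lagGrad lam).tendsto _).comp hpt)
  have he : Tendsto e (𝓝 x) (𝓝 0) := by
    have h1 : ∀ i, Tendsto (a i) (𝓝 x) (𝓝 (a i x)) := by
      intro i
      have h2 : a i = fun u => sndL (gradient (joint (P.h i)) (pt u (Y u))) := by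
        funext u
        exact gradient_eq_snd ((hP.contDiff_h i).differentiable one_ne_zero) _ _
      rw [h2]
      exact (sndL.continuous.tendsto _).comp
        (((continuous_gradient (hP.contDiff_h i)).tendsto _).comp hpt)
    have h3 := tendsto_finsetSum Finset.univ
      fun i (_ : i ∈ Finset.univ) => ((h1 i).sub_const (a i x)).norm
    simpa [e] using h3
  rw [tendsto_iff_norm_sub_tendsto_zero]
  refine squeeze_zero' (Eventually.of_forall fun _ => norm_nonneg _) (g := fun u => 2 / s * ‖r u‖)
    ?_ (by simpa using hr.norm.const_mul (2 / s))
  filter_upwards [hl, hP.eventually_activeSet_subset hc, he.eventually_lt_const (half_pos hs)]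
    with u hu hsub heu
  set v := l u - lam with hv
  have hv0 : ∀ i ∉ P.activeSet x (Y x), v i = 0 := by
    intro i hi
    rw [hv, PiLp.sub_apply, hlam.eq_zero_of_notMem hi, hu.eq_zero_of_notMem (fun h => hi (hsub h)),
      sub_zero]
  have h1 : ∑ i, v i • a i u = -r u := by
    have h2 : r u = gradient (ψ u) (Y u) + ∑ i, lam i • a i u := hP.lagGrad_snd lam u (Y u)
    have h3 : gradient (ψ u) (Y u) + ∑ i, l u i • a i u = 0 := hu.2.2
    simp only [hv, PiLp.sub_apply, sub_smul, Finset.sum_sub_distrib]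
    rw [h2, eq_neg_of_add_eq_zero_right h3]
    abel
  have h4 : ∑ i, v i • a i x = -r u - ∑ i, v i • (a i u - a i x) := by
    simp only [smul_sub, Finset.sum_sub_distrib, h1]
    abel
  have h5 : s * ‖v‖ ≤ ‖r u‖ + ‖v‖ * e u := by
    refine (hJ v hv0).trans ?_
    change ‖∑ i, v i • a i x‖ ≤ _
    rw [h4]
    refine (norm_sub_le _ _).trans ?_
    rw [norm_neg]
    gcongr
    exact norm_sum_smul_le v _
  have h6 : s / 2 * ‖v‖ ≤ ‖r u‖ := by nlinarith [norm_nonneg v]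
  rw [div_mul_eq_mul_div, le_div_iff₀ hs]
  linarith

/-! ### Second-order facts and the derivative of the minimizer -/

/-- Strong convexity, known between feasible points only, bounds the Hessian from below at interior
points of the domain, and by continuity at their limits. -/
lemma IsProgram.le_inner_hessian {ψ : Vec dx → Vec dy → ℝ} {ν : ℝ} (hP : P.IsProgram ψ ν)
    {p : Joint dx dy} (hpd : p ∈ P.domain) (hp : p ∈ closure (interior P.domain)) (η : Vec dy) :
    ν * ‖η‖ ^ 2 ≤ ⟪hessian (joint ψ) p (pt 0 η), pt 0 η⟫_ℝ := by
  have : (𝓝[interior P.domain] p).NeBot := mem_closure_iff_nhdsWithin_neBot.1 hp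
  have hc := (hP.cont_obj p hpd).mono interior_subset
  have hc' : Tendsto (fun q => ⟪hessian (joint ψ) q (pt 0 η), pt 0 η⟫_ℝ) (𝓝[interior P.domain] p)
      (𝓝 ⟪hessian (joint ψ) p (pt 0 η), pt 0 η⟫_ℝ) :=
    (hc.clm_apply tendsto_const_nhds).inner tendsto_const_nhds
  refine ge_of_tendsto hc' ?_
  filter_upwards [self_mem_nhdsWithin] with q hq
  have hqd : q ∈ P.domain := interior_subset hq
  refine le_inner_fderiv_apply (hP.diff_obj q hqd) ?_
  have hcurve : Continuous fun s : ℝ => q + s • pt 0 η := by fun_prop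
  have hev : ∀ᶠ s : ℝ in 𝓝[>] 0, q + s • pt 0 η ∈ interior P.domain := by
    refine ((hcurve.tendsto 0).mono_left nhdsWithin_le_nhds).eventually
      (isOpen_interior.mem_nhds ?_)
    simpa using hq
  filter_upwards [hev, self_mem_nhdsWithin] with s hs (h0 : 0 < s)
  obtain ⟨x, w, rfl⟩ : ∃ x w, q = pt x w := ⟨q.fst, q.snd, rfl⟩
  rw [pt_add_smul] at hs ⊢
  have hw : w ∈ P.feasible x := hqd
  have hw' : w + s • η ∈ P.feasible x := P.pt_mem_domain.1 (interior_subset hs)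
  have h1 := hP.growth x w hw _ hw'
  have h2 := hP.growth x _ hw' w hw
  rw [gradient_eq_snd (hP.contDiff_obj.differentiable one_ne_zero)] at h1 h2
  rw [inner_pt, inner_zero_right, zero_add]
  have e1 : w - (w + s • η) = -(s • η) := by abel
  rw [add_sub_cancel_left, real_inner_smul_right, norm_smul, Real.norm_of_nonneg h0.le] at h1
  rw [e1, inner_neg_right, norm_neg, real_inner_smul_right, norm_smul,
    Real.norm_of_nonneg h0.le] at h2
  have h3 : (gradient (joint ψ) (pt x (w + s • η)) - gradient (joint ψ) (pt x w)).snd =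
    (gradient (joint ψ) (pt x (w + s • η))).snd - (gradient (joint ψ) (pt x w)).snd := rfl
  rw [h3, inner_sub_left]
  refine le_of_mul_le_mul_left ?_ h0
  nlinarith

lemma IsProgram.inner_hessian_h_nonneg {ψ : Vec dx → Vec dy → ℝ} {ν : ℝ} (hP : P.IsProgram ψ ν)
    {p : Joint dx dy} (hpd : p ∈ P.domain) (i : Fin m) (η : Vec dy) :
    0 ≤ ⟪hessian (joint (P.h i)) p (pt 0 η), pt 0 η⟫_ℝ := by
  refine le_inner_fderiv_apply (hP.diff_h i p hpd) ?_
  filter_upwards [self_mem_nhdsWithin] with s (h0 : 0 < s)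
  obtain ⟨x, w, rfl⟩ : ∃ x w, p = pt x w := ⟨p.fst, p.snd, rfl⟩
  have hd := (hP.contDiff_h i).differentiable one_ne_zero
  have hcv := strongConvexOn_zero.2 (hP.convex_h i x)
  have h1 := add_inner_add_le_of_strongConvexOn hcv (Set.mem_univ w) (Set.mem_univ (w + s • η))
    (hasGradientAt_of_joint hd x w)
  have h2 := add_inner_add_le_of_strongConvexOn hcv (Set.mem_univ (w + s • η)) (Set.mem_univ w)
    (hasGradientAt_of_joint hd x _)
  rw [pt_add_smul, inner_pt, inner_zero_right, zero_add, zero_mul]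
  have e1 : w - (w + s • η) = -(s • η) := by abel
  rw [add_sub_cancel_left, real_inner_smul_right] at h1
  rw [e1, inner_neg_right, real_inner_smul_right] at h2
  have h3 : (gradient (joint (P.h i)) (pt x (w + s • η)) - gradient (joint (P.h i)) (pt x w)).snd =
    (gradient (joint (P.h i)) (pt x (w + s • η))).snd -
      (gradient (joint (P.h i)) (pt x w)).snd := rfl
  rw [h3, inner_sub_left]
  refine le_of_mul_le_mul_left ?_ h0
  nlinarith

lemma IsProgram.le_inner_lagHess {ψ : Vec dx → Vec dy → ℝ} {ν : ℝ} (hP : P.IsProgram ψ ν)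
    {p : Joint dx dy} (hpd : p ∈ P.domain) (hp : p ∈ closure (interior P.domain)) {lam : Vec m}
    (hlam : ∀ i, 0 ≤ lam i) (η : Vec dy) :
    ν * ‖η‖ ^ 2 ≤ ⟪(P.lagHess ψ lam p (pt 0 η)).snd, η⟫_ℝ := by
  have e : ⟪(P.lagHess ψ lam p (pt 0 η)).snd, η⟫_ℝ =
      ⟪hessian (joint ψ) p (pt 0 η), pt 0 η⟫_ℝ +
        ∑ i, lam i * ⟪hessian (joint (P.h i)) p (pt 0 η), pt 0 η⟫_ℝ := by
    have : ⟪(P.lagHess ψ lam p (pt 0 η)).snd, η⟫_ℝ = ⟪P.lagHess ψ lam p (pt 0 η), pt 0 η⟫_ℝ := by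
      rw [inner_pt, inner_zero_right, zero_add]
    rw [this, lagHess]
    simp only [add_apply, sum_apply,
      smul_apply, inner_add_left, sum_inner, real_inner_smul_left]
  rw [e]
  have h1 := hP.le_inner_hessian hpd hp η
  have h2 : 0 ≤ ∑ i, lam i * ⟪hessian (joint (P.h i)) p (pt 0 η), pt 0 η⟫_ℝ :=
    Finset.sum_nonneg fun i _ => mul_nonneg (hlam i) (hP.inner_hessian_h_nonneg hpd i η)
  linarith

/-- The `i`-th coordinate as a continuous linear functional. -/
def coordL {n : ℕ} (i : Fin n) : Vec n →L[ℝ] ℝ := EuclideanSpace.proj i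

section CombinationDeriv

variable {E F : Type*} [NormedAddCommGroup E] [NormedSpace ℝ E] [NormedAddCommGroup F]
  [NormedSpace ℝ F] {n : ℕ}

/-- The linear map `(ζ, ε) ↦ A ζ + ∑ i, ε i • b i`. -/
def combinationL (A : E →L[ℝ] F) (b : Fin n → F) : E × Vec n →L[ℝ] F :=
  A ∘L ContinuousLinearMap.fst ℝ E (Vec n) +
    ∑ i : Fin n, (coordL i ∘L ContinuousLinearMap.snd ℝ E (Vec n)).smulRight (b i)

lemma combinationL_apply (A : E →L[ℝ] F) (b : Fin n → F) (v : E × Vec n) :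
    combinationL A b v = A v.1 + ∑ i, v.2 i • b i := by
  simp only [combinationL, add_apply, sum_apply, ContinuousLinearMap.comp_apply,
    ContinuousLinearMap.smulRight_apply]
  rfl

lemma hasFDerivAt_combination {G₀ : E → F} {G : Fin n → E → F} {A : E →L[ℝ] F}
    {B : Fin n → E →L[ℝ] F} {p : E} {c : Vec n} (h₀ : HasFDerivAt G₀ A p)
    (h : ∀ i, HasFDerivAt (G i) (B i) p) :
    HasFDerivAt (fun v : E × Vec n => G₀ v.1 + ∑ i, v.2 i • G i v.1)
      (combinationL (A + ∑ i, c i • B i) fun i => G i p) (p, c) := by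
  have h1 : HasFDerivAt (fun v : E × Vec n => G₀ v.1) (A ∘L ContinuousLinearMap.fst ℝ E (Vec n))
      (p, c) := HasFDerivAt.comp (p, c) h₀ hasFDerivAt_fst
  have h2 : ∀ i, HasFDerivAt (fun v : E × Vec n => G i v.1)
      (B i ∘L ContinuousLinearMap.fst ℝ E (Vec n)) (p, c) := fun i =>
    HasFDerivAt.comp (p, c) (h i) hasFDerivAt_fst
  have h3 : ∀ i : Fin n, HasFDerivAt (fun v : E × Vec n => v.2 i)
      (coordL i ∘L ContinuousLinearMap.snd ℝ E (Vec n)) (p, c) :=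
    fun i => (coordL i ∘L ContinuousLinearMap.snd ℝ E (Vec n)).hasFDerivAt
  have h4 := h1.add (HasFDerivAt.fun_sum (u := Finset.univ) fun i _ => (h3 i).smul (h2 i))
  refine h4.congr_fderiv (ContinuousLinearMap.ext fun v => ?_)
  simp only [combinationL, add_apply, sum_apply, ContinuousLinearMap.comp_apply, smul_apply,
    ContinuousLinearMap.smulRight_apply, Finset.sum_add_distrib]
  abel

end CombinationDeriv

lemma IsProgram.hasFDerivAt_lagGrad {ψ : Vec dx → Vec dy → ℝ} {ν : ℝ} (hP : P.IsProgram ψ ν)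
    {p : Joint dx dy} (hpd : p ∈ P.domain) (lam : Vec m) :
    HasFDerivAt (fun v : Joint dx dy × Vec m => P.lagGrad ψ v.2 v.1)
      (combinationL (P.lagHess ψ lam p) fun i => gradient (joint (P.h i)) p) (p, lam) :=
  hasFDerivAt_combination (hP.diff_obj p hpd).hasFDerivAt
    fun i => (hP.diff_h i p hpd).hasFDerivAt

/-- The minimizer is differentiable at a regular parameter, and its derivative, together with that
of the multiplier, solves the linearized Karush-Kuhn-Tucker system. -/
theorem IsProgram.exists_hasFDerivAt {ψ : Vec dx → Vec dy → ℝ} {ν : ℝ} (hP : P.IsProgram ψ ν)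
    (hν : 0 < ν) {Y : Vec dx → Vec dy} (hY : ∀ u, Y u ∈ P.feasible u)
    (hmin : ∀ u, IsMinOn (ψ u) (P.feasible u) (Y u)) {x : Vec dx} (hL : P.LICQ x (Y x))
    {s : ℝ} (hs : 0 < s) (hJ : P.JacobianLower s x (Y x))
    {lam : Vec m} (hlam : P.IsKKT ψ x (Y x) lam) (hpos : ∀ i ∈ P.activeSet x (Y x), 0 < lam i) :
    ∃ (D : Vec dx →L[ℝ] Vec dy) (E : Vec dx →L[ℝ] Vec m), HasFDerivAt Y D x ∧ ∀ ξ,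
      (P.lagHess ψ lam (pt x (Y x)) (pt ξ (D ξ)) +
        ∑ i, E ξ i • gradient (joint (P.h i)) (pt x (Y x))).snd = 0 ∧
      (∀ i ∈ P.activeSet x (Y x), ⟪gradient (joint (P.h i)) (pt x (Y x)), pt ξ (D ξ)⟫_ℝ = 0) ∧
      ∀ i ∉ P.activeSet x (Y x), E ξ i = 0 := by
  classical
  set I := P.activeSet x (Y x) with hI
  set p := pt x (Y x) with hp
  have hpd : p ∈ P.domain := hY x
  have hpc : p ∈ closure (interior P.domain) := hL.mem_closure_interior hP.contDiff_h (hY x)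
  have hc := hP.continuousAt_minimizer hν hY hmin hL
  have hex : ∀ᶠ u in 𝓝 x, ∃ l, P.IsKKT ψ u (Y u) l := by
    filter_upwards [hP.eventually_LICQ hc hL] with u hu
    exact hu.exists_isKKT hP.contDiff_h hP.contDiff_obj (hY u) (hmin u)
  let l : Vec dx → Vec m := fun u => Classical.epsilon fun l => P.IsKKT ψ u (Y u) l
  have hl : ∀ᶠ u in 𝓝 x, P.IsKKT ψ u (Y u) (l u) := by
    filter_upwards [hex] with u hu using Classical.epsilon_spec hu
  have hlt : Tendsto l (𝓝 x) (𝓝 lam) := hP.tendsto_multiplier hc hs hJ hlam hl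
  have hlx : l x = lam := eq_of_tendsto_nhds hlt
  let z : Vec dx → Vec dy × Vec m := fun u => (Y u, l u)
  have hz : ContinuousAt z x := by
    refine hc.prodMk ?_
    rw [ContinuousAt, hlx]; exact hlt
  -- the active part of the Karush-Kuhn-Tucker system, as an equation; for an inactive index the
  -- constraint is replaced by the vanishing of its multiplier, which makes the system square
  let Q : Vec dx × (Vec dy × Vec m) →L[ℝ] Joint dx dy :=
    ptL ∘L (ContinuousLinearMap.fst ℝ (Vec dx) (Vec dy × Vec m)).prod
      (ContinuousLinearMap.fst ℝ (Vec dy) (Vec m) ∘L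
        ContinuousLinearMap.snd ℝ (Vec dx) (Vec dy × Vec m))
  let R : Vec dx × (Vec dy × Vec m) →L[ℝ] Vec m :=
    ContinuousLinearMap.snd ℝ (Vec dy) (Vec m) ∘L
      ContinuousLinearMap.snd ℝ (Vec dx) (Vec dy × Vec m)
  let F : Vec dx × (Vec dy × Vec m) → Vec dy × (Fin m → ℝ) := fun v =>
    (sndL (P.lagGrad ψ (R v) (Q v)), fun i => if i ∈ I then joint (P.h i) (Q v) else R v i)
  let F₁ : Vec dx × (Vec dy × Vec m) →L[ℝ] Vec dy :=
    sndL.comp ((combinationL (P.lagHess ψ lam p) fun i => gradient (joint (P.h i)) p).comp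
      (Q.prod R))
  let F₂ : Fin m → Vec dx × (Vec dy × Vec m) →L[ℝ] ℝ := fun i =>
    if i ∈ I then (InnerProductSpace.toDual ℝ _ (gradient (joint (P.h i)) p)) ∘L Q
      else (coordL i).comp R
  have hQz : Q (x, z x) = p := rfl
  have hRz : R (x, z x) = lam := hlx
  have hF : HasFDerivAt F (F₁.prod (ContinuousLinearMap.pi F₂)) (x, z x) := by
    refine HasFDerivAt.prodMk ?_ ?_
    · have h1 := hP.hasFDerivAt_lagGrad hpd lam
      rw [← hQz, ← hRz] at h1
      have h2 := HasFDerivAt.comp (x, z x) h1 (Q.prod R).hasFDerivAt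
      rw [hQz, hRz] at h2
      exact sndL.hasFDerivAt.comp (x, z x) h2
    · refine hasFDerivAt_pi.2 fun i => ?_
      by_cases hi : i ∈ I
      · simp only [hi, if_true, F₂]
        have h1 := (((hP.contDiff_h i).differentiable one_ne_zero) p).hasGradientAt.hasFDerivAt
        rw [← hQz] at h1
        exact HasFDerivAt.comp (x, z x) h1 Q.hasFDerivAt
      · simp only [hi, if_false, F₂]
        exact ((coordL i).comp R).hasFDerivAt
  have hF1 : ∀ v, F₁ v = (P.lagHess ψ lam p (Q v) +
      ∑ i, R v i • gradient (joint (P.h i)) p).snd := by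
    intro v
    exact congrArg WithLp.snd (combinationL_apply (P.lagHess ψ lam p)
      (fun i => gradient (joint (P.h i)) p) (Q v, R v))
  have hF2 : ∀ v, ContinuousLinearMap.pi F₂ v = 0 →
      (∀ i ∈ I, ⟪gradient (joint (P.h i)) p, Q v⟫_ℝ = 0) ∧ ∀ i ∉ I, R v i = 0 := by
    intro v hv
    refine ⟨fun i hi => ?_, fun i hi => ?_⟩
    · have := congrFun hv i
      simp only [ContinuousLinearMap.pi_apply, F₂, hi, if_true] at this
      exact this
    · have := congrFun hv i
      simp only [ContinuousLinearMap.pi_apply, F₂, hi, if_false] at this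
      exact this
  have hgr : ∀ i, gradient (P.h i x) (Y x) = (gradient (joint (P.h i)) p).snd := fun i =>
    gradient_eq_snd ((hP.contDiff_h i).differentiable one_ne_zero) _ _
  -- pairing the first equation with `η` kills the multiplier terms, so `η = 0` by strong
  -- convexity, and then `ε = 0` by independence of the active gradients
  have hinj : ∀ v, (F₁.prod (ContinuousLinearMap.pi F₂)) (0, v) = 0 → v = 0 := by
    rintro ⟨η, ε⟩ hv
    have hv1 : F₁ (0, η, ε) = 0 := congrArg Prod.fst hv
    obtain ⟨hv2, hv3⟩ := hF2 (0, η, ε) (congrArg Prod.snd hv)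
    rw [hF1] at hv1
    change (P.lagHess ψ lam p (pt 0 η) + ∑ i, ε i • gradient (joint (P.h i)) p).snd = 0 at hv1
    change ∀ i ∈ I, ⟪gradient (joint (P.h i)) p, pt 0 η⟫_ℝ = 0 at hv2
    change ∀ i ∉ I, ε i = 0 at hv3
    have h1 : (P.lagHess ψ lam p (pt 0 η)).snd + ∑ i, ε i • gradient (P.h i x) (Y x) = 0 := by
      simp_rw [hgr, ← sndL_apply, ← map_smul, ← map_sum, ← map_add]
      exact hv1
    have h2 : ∑ i, ε i * ⟪gradient (P.h i x) (Y x), η⟫_ℝ = 0 := by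
      refine Finset.sum_eq_zero fun i _ => ?_
      by_cases hi : i ∈ I
      · have := hv2 i hi
        rw [inner_pt, inner_zero_right, zero_add] at this
        rw [hgr, this, mul_zero]
      · rw [hv3 i hi, zero_mul]
    have h3 : ⟪(P.lagHess ψ lam p (pt 0 η)).snd, η⟫_ℝ = 0 := by
      rw [eq_neg_of_add_eq_zero_left h1, inner_neg_left, sum_inner]
      simp_rw [real_inner_smul_left]
      rw [h2, neg_zero]
    have h4 := hP.le_inner_lagHess hpd hpc hlam.1 η
    have hη : η = 0 := by
      rw [h3] at h4
      have : ‖η‖ ^ 2 ≤ 0 := nonpos_of_mul_nonpos_right h4 hν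
      exact norm_eq_zero.1 (pow_eq_zero_iff two_ne_zero |>.1 (le_antisymm this (sq_nonneg _)))
    have hε : ε = 0 := by
      have h5 := hJ ε hv3
      rw [← zero_add (∑ i, ε i • gradient (P.h i x) (Y x))] at h5
      have h6 : (P.lagHess ψ lam p (pt 0 η)).snd = 0 := by
        rw [hη]; change sndL (P.lagHess ψ lam p (pt 0 0)) = 0
        rw [show (pt (0 : Vec dx) (0 : Vec dy)) = 0 from rfl, map_zero, map_zero]
      rw [← h6, h1, norm_zero] at h5
      exact norm_eq_zero.1 (le_antisymm (nonpos_of_mul_nonpos_right h5 hs) (norm_nonneg _))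
    rw [hη, hε]; rfl
  -- strict complementarity keeps the constraints in `I` active at nearby parameters
  have h0 : ∀ᶠ u in 𝓝 x, F (u, z u) = 0 := by
    have hposu : ∀ᶠ u in 𝓝 x, ∀ i ∈ I, 0 < l u i := by
      rw [eventually_all_finset]
      intro i hi
      have h1 : Tendsto (fun u => l u i) (𝓝 x) (𝓝 (lam i)) :=
        ((coordL i).continuous.tendsto lam).comp hlt
      exact h1.eventually_const_lt (hpos i hi)
    filter_upwards [hl, hposu, hP.eventually_activeSet_subset hc] with u hu hup hsub
    refine Prod.ext ?_ (funext fun i => ?_)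
    · change (P.lagGrad ψ (l u) (pt u (Y u))).snd = 0
      rw [hP.lagGrad_snd]; exact hu.2.2
    · change (if i ∈ I then P.h i u (Y u) else l u i) = 0
      split_ifs with hi
      · exact (mul_eq_zero.1 (hu.2.1 i)).resolve_left (hup i hi).ne'
      · exact hu.eq_zero_of_notMem fun h => hi (hsub h)
  obtain ⟨D, hD, hlin⟩ := exists_hasFDerivAt_of_eventually_eq_zero hF hz hinj h0
  refine ⟨ContinuousLinearMap.fst ℝ (Vec dy) (Vec m) ∘L D,
    ContinuousLinearMap.snd ℝ (Vec dy) (Vec m) ∘L D,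
    hD.fst, fun ξ => ?_⟩
  have h1 : F₁ (ξ, D ξ) = 0 := congrArg Prod.fst (hlin ξ)
  rw [hF1] at h1
  exact ⟨h1, hF2 (ξ, D ξ) (congrArg Prod.snd (hlin ξ))⟩

/-! ### Value functions -/

/-- Chain rule for `u ↦ F u (Y u)`, in terms of the joint gradient of `F`. -/
lemma hasFDerivAt_along {F : Vec dx → Vec dy → ℝ} {Y : Vec dx → Vec dy} {x : Vec dx}
    {D : Vec dx →L[ℝ] Vec dy} (hF : DifferentiableAt ℝ (joint F) (pt x (Y x)))
    (hY : HasFDerivAt Y D x) :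
    DifferentiableAt ℝ (fun u => F u (Y u)) x ∧
      ∀ ξ, ⟪gradient (fun u => F u (Y u)) x, ξ⟫_ℝ =
        ⟪gradient (joint F) (pt x (Y x)), pt ξ (D ξ)⟫_ℝ := by
  have h1 : HasFDerivAt (fun u => pt u (Y u)) (ptL ∘L (ContinuousLinearMap.id ℝ (Vec dx)).prod D)
      x := ptL.hasFDerivAt.comp x ((hasFDerivAt_id x).prodMk hY)
  have h2 := HasFDerivAt.comp x hF.hasFDerivAt h1
  refine ⟨h2.differentiableAt, fun ξ => ?_⟩
  rw [gradient, InnerProductSpace.toDual_symm_apply, gradient,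
    InnerProductSpace.toDual_symm_apply]
  exact congrArg (fun L : Vec dx →L[ℝ] ℝ => L ξ) h2.fderiv

/-- The envelope formula: the gradient of the value function is the partial gradient in the
parameter of the Lagrangian. -/
lemma IsProgram.gradient_value {ψ : Vec dx → Vec dy → ℝ} {ν : ℝ} (hP : P.IsProgram ψ ν)
    {Y : Vec dx → Vec dy} {x : Vec dx} {lam : Vec m} (hlam : P.IsKKT ψ x (Y x) lam)
    {D : Vec dx →L[ℝ] Vec dy} (hY : HasFDerivAt Y D x)
    (hD : ∀ ξ, ∀ i ∈ P.activeSet x (Y x),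
      ⟪gradient (joint (P.h i)) (pt x (Y x)), pt ξ (D ξ)⟫_ℝ = 0) :
    gradient (fun u => ψ u (Y u)) x = (P.lagGrad ψ lam (pt x (Y x))).fst := by
  refine ext_inner_right ℝ fun ξ => ?_
  rw [(hasFDerivAt_along (hP.contDiff_obj.differentiable one_ne_zero _) hY).2 ξ]
  have h1 : ⟪P.lagGrad ψ lam (pt x (Y x)), pt ξ (D ξ)⟫_ℝ =
      ⟪(P.lagGrad ψ lam (pt x (Y x))).fst, ξ⟫_ℝ := by
    rw [inner_pt, hP.lagGrad_snd, hlam.2.2, inner_zero_left, add_zero]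
  rw [← h1, lagGrad, inner_add_left, sum_inner, Finset.sum_eq_zero, add_zero]
  intro i _
  rw [real_inner_smul_left]
  by_cases hi : i ∈ P.activeSet x (Y x)
  · rw [hD ξ i hi, mul_zero]
  · rw [hlam.eq_zero_of_notMem hi, zero_mul]

/-- Strong convexity makes the objective coercive on the feasible set. -/
lemma IsProgram.exists_isMinOn {ψ : Vec dx → Vec dy → ℝ} {ν : ℝ} (hP : P.IsProgram ψ ν)
    (hν : 0 < ν) {x : Vec dx} (hc : IsClosed (P.feasible x)) (hne : (P.feasible x).Nonempty) :
    ∃ y ∈ P.feasible x, IsMinOn (ψ x) (P.feasible x) y := by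
  obtain ⟨w, hw⟩ := hne
  have hcont : Continuous (ψ x) :=
    hP.contDiff_obj.continuous.comp (continuous_pt.comp (by fun_prop : Continuous fun y => (x, y)))
  refine hcont.continuousOn.exists_isMinOn' hc hw ?_
  set G := gradient (ψ x) w with hG
  have hfar : ∀ᶠ y in cocompact (Vec dy) ⊓ 𝓟 (P.feasible x), 2 * ‖G‖ / ν ≤ ‖y - w‖ := by
    refine Filter.Eventually.filter_mono inf_le_left ?_
    have h1 : Tendsto (fun y : Vec dy => ‖y - w‖) (cocompact _) atTop :=
      tendsto_norm_cocompact_atTop.comp (Homeomorph.subRight w).isClosedEmbedding.tendsto_cocompact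
    exact h1.eventually_ge_atTop _
  filter_upwards [hfar, mem_inf_of_right (mem_principal_self _)] with y hy hyf
  have h1 := hP.growth x w hw y hyf
  have h2 := (abs_le.1 (abs_real_inner_le_norm G (y - w))).1
  rw [div_le_iff₀ hν] at hy
  nlinarith [norm_nonneg (y - w), norm_nonneg G]

/-! ### The standing assumptions -/

section Penalty

variable {c : Constants}

lemma gPen_zero : P.gPen 0 = P.g := by
  funext x y; simp [gPen]

lemma yStarPen_zero (x : Vec dx) : P.yStarPen 0 x = P.yStar x := by
  rw [yStarPen, gPen_zero, yStar]

section Combination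

variable {E : Type*} [NormedAddCommGroup E] [InnerProductSpace ℝ E]

lemma contDiff_const_mul_add {F G : E → ℝ} (t : ℝ) (hF : ContDiff ℝ 1 F) (hG : ContDiff ℝ 1 G) :
    ContDiff ℝ 1 fun p => t * F p + G p :=
  (contDiff_const.mul hF).add hG

lemma gradient_const_mul_add [CompleteSpace E] {F G : E → ℝ} (t : ℝ) (hF : Differentiable ℝ F)
    (hG : Differentiable ℝ G) :
    gradient (fun p => t * F p + G p) = fun p => t • gradient F p + gradient G p := by
  funext p
  have h := ((hF p).hasFDerivAt.const_mul t).add (hG p).hasFDerivAt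
  rw [gradient, show fderiv ℝ (fun p => t * F p + G p) p = t • fderiv ℝ F p + fderiv ℝ G p
    from h.fderiv, map_add, map_smulₛₗ]
  rfl

lemma hasFDerivAt_const_smul_add {F G : E → E} {p : E} (t : ℝ) (hF : DifferentiableAt ℝ F p)
    (hG : DifferentiableAt ℝ G p) :
    HasFDerivAt (fun p => t • F p + G p) (t • fderiv ℝ F p + fderiv ℝ G p) p :=
  (hF.hasFDerivAt.const_smul t).add hG.hasFDerivAt

lemma hessian_eq_of_hasFDerivAt [CompleteSpace E] {F : E → ℝ} {p : E} {A : E →L[ℝ] E}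
    (h : HasFDerivAt (gradient F) A p) : hessian F p = A := h.fderiv

lemma continuousOn_const_smul_add {F G : E → E →L[ℝ] E} {S : Set E} (t : ℝ)
    (hF : ContinuousOn F S) (hG : ContinuousOn G S) :
    ContinuousOn (fun p => t • F p + G p) S :=
  (hF.const_smul t).add hG

end Combination

lemma Standing.gradient_gPen (hS : P.Standing c) (t : ℝ) :
    gradient (joint (P.gPen t)) =
      fun p => t • gradient (joint P.f) p + gradient (joint P.g) p :=
  gradient_const_mul_add t (hS.hess_f.1.differentiable one_ne_zero)
    (hS.hess_g.1.differentiable one_ne_zero)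

lemma Standing.hasFDerivAt_gradient_gPen (hS : P.Standing c) (t : ℝ) {p : Joint dx dy}
    (hp : p ∈ P.domain) :
    HasFDerivAt (gradient (joint (P.gPen t)))
      (t • hessian (joint P.f) p + hessian (joint P.g) p) p := by
  rw [hS.gradient_gPen]
  exact hasFDerivAt_const_smul_add t (hS.hess_f.2 p hp) (hS.hess_g.2 p hp)

lemma Standing.contDiff_gPen (hS : P.Standing c) (t : ℝ) : ContDiff ℝ 1 (joint (P.gPen t)) :=
  contDiff_const_mul_add t hS.hess_f.1 hS.hess_g.1

lemma norm_gradient_snd_sub_le {F : Vec dx → Vec dy → ℝ} {l : ℝ≥0}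
    (hl : LipschitzOnWith l (gradient (joint F)) P.domain) {x : Vec dx} {y y' : Vec dy}
    (hy : y ∈ P.feasible x) (hy' : y' ∈ P.feasible x) :
    ‖(gradient (joint F) (pt x y)).snd - (gradient (joint F) (pt x y')).snd‖ ≤ l * ‖y - y'‖ := by
  have h1 := hl.norm_sub_le (P.pt_mem_domain.2 hy) (P.pt_mem_domain.2 hy')
  rw [pt_sub, sub_self, norm_pt_zero] at h1
  exact (norm_snd_le (gradient (joint F) (pt x y) - gradient (joint F) (pt x y'))).trans h1

lemma smul_add_snd (t : ℝ) (p q : Joint dx dy) : (t • p + q).snd = t • p.snd + q.snd := by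
  rw [WithLp.add_snd, WithLp.smul_snd]

/-- The `l_{f,1}`-Lipschitz gradient of `f` costs at most half of the strong convexity of `g` as
long as `2 * l_{f,1} * t ≤ μ_g`. -/
lemma Standing.growth_gPen (hS : P.Standing c) {t : ℝ} (ht : 0 ≤ t)
    (htμ : 2 * (c.lf1 : ℝ) * t ≤ c.μg) {x : Vec dx} {w y : Vec dy} (hw : w ∈ P.feasible x)
    (hy : y ∈ P.feasible x) :
    P.gPen t x w + ⟪gradient (P.gPen t x) w, y - w⟫_ℝ + c.μg / 2 / 2 * ‖y - w‖ ^ 2 ≤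
      P.gPen t x y := by
  have hg := add_inner_add_le_of_strongConvexOn (hS.strongConvex_g x) hw hy
    (hasGradientAt_of_joint (hS.hess_g.1.differentiable one_ne_zero) x w)
  have hf := add_inner_sub_le_of_lipschitzOnWith (hS.convex x) (φ := P.f x)
    (G := fun y => (gradient (joint P.f) (pt x y)).snd) (l := c.lf1)
    (fun z _ => hasGradientAt_of_joint (hS.hess_f.1.differentiable one_ne_zero) x z)
    (fun z hz z' hz' => norm_gradient_snd_sub_le hS.lip_grad_f hz hz') hw hy
  rw [gradient_eq_snd ((hS.contDiff_gPen t).differentiable one_ne_zero), hS.gradient_gPen,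
    smul_add_snd, inner_add_left, real_inner_smul_left, gPen, gPen]
  generalize ⟪(gradient (joint P.f) (pt x w)).snd, y - w⟫_ℝ = a at *
  generalize ⟪(gradient (joint P.g) (pt x w)).snd, y - w⟫_ℝ = b at *
  have h1 := mul_le_mul_of_nonneg_left hf ht
  have h2 := mul_le_mul_of_nonneg_right htμ (sq_nonneg ‖y - w‖)
  nlinarith

lemma Standing.hessian_gPen (hS : P.Standing c) (t : ℝ) {p : Joint dx dy} (hp : p ∈ P.domain) :
    hessian (joint (P.gPen t)) p = t • hessian (joint P.f) p + hessian (joint P.g) p :=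
  hessian_eq_of_hasFDerivAt (hS.hasFDerivAt_gradient_gPen t hp)

lemma Standing.continuousOn_hessian_gPen (hS : P.Standing c) (t : ℝ) :
    ContinuousOn (hessian (joint (P.gPen t))) P.domain := by
  have hf : ContinuousOn (hessian (joint P.f)) P.domain := hS.lip_hess_f.continuousOn
  have hg : ContinuousOn (hessian (joint P.g)) P.domain := hS.lip_hess_g.continuousOn
  have h := continuousOn_const_smul_add t hf hg
  exact h.congr fun _ hp => hS.hessian_gPen t hp

lemma Standing.isProgram (hS : P.Standing c) {t : ℝ} (ht : 0 ≤ t)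
    (htμ : 2 * (c.lf1 : ℝ) * t ≤ c.μg) : P.IsProgram (P.gPen t) (c.μg / 2) where
  contDiff_obj := hS.contDiff_gPen t
  contDiff_h i := (hS.hess_h i).1
  diff_obj _ hp := (hS.hasFDerivAt_gradient_gPen t hp).differentiableAt
  diff_h i := (hS.hess_h i).2
  cont_obj := hS.continuousOn_hessian_gPen t
  convex_h := hS.convex_h
  growth _ _ hw _ hy := hS.growth_gPen ht htμ hw hy

lemma Standing.yStarPen_spec (hS : P.Standing c) (hμ : 0 < c.μg) {t : ℝ} (ht : 0 ≤ t)
    (htμ : 2 * (c.lf1 : ℝ) * t ≤ c.μg) (x : Vec dx) :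
    P.yStarPen t x ∈ P.feasible x ∧ IsMinOn (P.gPen t x) (P.feasible x) (P.yStarPen t x) := by
  obtain ⟨y, hy, hmin⟩ := (hS.isProgram ht htμ).exists_isMinOn (by positivity) (hS.closed x)
    (hS.nonempty x)
  exact Classical.epsilon_spec
    (p := fun y => y ∈ P.feasible x ∧ IsMinOn (P.gPen t x) (P.feasible x) y) ⟨y, hy, hmin⟩

/-- `Φ_δ` is the difference quotient at `δ` of the optimal value `min (t f + g)` in `t`. -/
lemma Standing.ΦPen_eq (hS : P.Standing c) (hμ : 0 < c.μg) {δ : ℝ} (hδ : 0 < δ)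
    (hδμ : 2 * (c.lf1 : ℝ) * δ ≤ c.μg) :
    P.ΦPen δ = fun x => δ⁻¹ * (P.gPen δ x (P.yStarPen δ x) - P.gPen 0 x (P.yStarPen 0 x)) := by
  funext x
  have h0 := hS.yStarPen_spec hμ le_rfl (t := 0) (by simpa using hμ.le) x
  have hd := hS.yStarPen_spec hμ hδ.le hδμ x
  rw [gPen_zero] at h0 ⊢
  set y₀ := P.yStarPen 0 x
  set y₁ := P.yStarPen δ x
  have hne : Nonempty (P.feasible x) := (hS.nonempty x).to_subtype
  have hsup : ∀ y : P.feasible x,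
      (⨆ z : P.feasible x, P.f x y + 1 / δ * (P.g x y - P.g x z)) =
        δ⁻¹ * (P.gPen δ x y - P.g x y₀) := by
    intro y
    have e : δ⁻¹ * (P.gPen δ x y - P.g x y₀) = P.f x y + 1 / δ * (P.g x y - P.g x y₀) := by
      rw [gPen]; field_simp; ring
    rw [e]
    have hle : ∀ z : P.feasible x, P.f x y + 1 / δ * (P.g x y - P.g x z) ≤
        P.f x y + 1 / δ * (P.g x y - P.g x y₀) := by
      intro z
      have : P.g x y₀ ≤ P.g x z := h0.2 z.2
      gcongr
    exact le_antisymm (ciSup_le hle) (le_ciSup (f := fun z : P.feasible x =>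
      P.f x y + 1 / δ * (P.g x y - P.g x z)) ⟨_, Set.forall_mem_range.2 hle⟩ ⟨y₀, h0.1⟩)
  rw [ΦPen]
  simp_rw [hsup]
  have hge : ∀ y : P.feasible x, δ⁻¹ * (P.gPen δ x y₁ - P.g x y₀) ≤
      δ⁻¹ * (P.gPen δ x y - P.g x y₀) := by
    intro y
    have : P.gPen δ x y₁ ≤ P.gPen δ x y := hd.2 y.2
    gcongr
  exact le_antisymm (ciInf_le (f := fun y : P.feasible x => δ⁻¹ * (P.gPen δ x y - P.g x y₀))
    ⟨_, Set.forall_mem_range.2 hge⟩ ⟨y₁, hd.1⟩) (le_ciInf hge)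

/-- The lower bound on the singular values of the active Jacobian, as a lower bound for linear
combinations of the active gradients. -/
lemma JacobianBounds.jacobianLower {x : Vec dx} {y : Vec dy} (hJ : P.JacobianBounds c x y)
    (hs : 0 ≤ c.smin) (hL : P.LICQ x y) : P.JacobianLower c.smin x y := by
  intro v hv
  set I := P.activeSet x y with hI
  set T := Matrix.toEuclideanLin (P.activeJacobian x y) with hT
  have hTapp : ∀ w i, T w i = ⟪gradient (P.h i x) y, w⟫_ℝ := by
    intro w i
    rw [PiLp.inner_apply]
    have h1 : T w i = ∑ j, gradient (P.h i x) y j * w j := rfl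
    rw [h1]
    exact Finset.sum_congr rfl fun j _ => mul_comm (gradient (P.h i x) y j) (w j)
  have hsurj : Function.Surjective T := by
    intro b
    obtain ⟨d, hd⟩ := exists_inner_eq_of_linearIndependent hL b
    exact ⟨d, PiLp.ext fun i => by rw [hTapp]; exact hd i⟩
  let v' : EuclideanSpace ℝ I := WithLp.toLp 2 fun i => v i
  have hnorm : ‖v'‖ = ‖v‖ := by
    rw [EuclideanSpace.norm_eq, EuclideanSpace.norm_eq]
    congr 1
    rw [← Finset.sum_subset (Finset.subset_univ I) fun i _ hi => by simp [hv i hi],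
      ← Finset.sum_coe_sort I]
  have hadj : LinearMap.adjoint T v' = ∑ i, v i • gradient (P.h i x) y := by
    refine ext_inner_left ℝ fun w => ?_
    rw [LinearMap.adjoint_inner_right, inner_sum, PiLp.inner_apply,
      ← Finset.sum_subset (Finset.subset_univ I) fun i _ hi => by simp [hv i hi],
      ← Finset.sum_coe_sort I]
    refine Finset.sum_congr rfl fun i _ => ?_
    rw [hTapp, real_inner_smul_right, real_inner_comm w]
    simp [v']
  rw [← hadj, ← hnorm]
  refine mul_norm_le_norm_adjoint T hsurj hs (fun k hk => ?_) v'
  rw [finrank_euclideanSpace, Fintype.card_coe] at hk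
  exact (hJ k hk).1

end Penalty

/-! ### Bounds at regular points -/

section Bounds

variable {E : Type*} [NormedAddCommGroup E] [InnerProductSpace ℝ E] [CompleteSpace E]

lemma norm_gradient_le_of_mem_closure_interior {F : E → ℝ} {S : Set E} {l : ℝ≥0}
    (hF : ContDiff ℝ 1 F) (hl : LipschitzOnWith l F S) {p : E} (hp : p ∈ closure (interior S)) :
    ‖gradient F p‖ ≤ l := by
  rw [gradient, LinearIsometryEquiv.norm_map]
  exact norm_fderiv_le_of_mem_closure_interior hl
    (hF.continuous_fderiv one_ne_zero).continuousWithinAt hp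

lemma norm_hessian_le_of_mem_closure_interior {F : E → ℝ} {S : Set E} {l l' : ℝ≥0}
    (hl : LipschitzOnWith l (gradient F) S) (hl' : LipschitzOnWith l' (hessian F) S) {p : E}
    (hpS : p ∈ S) (hp : p ∈ closure (interior S)) : ‖hessian F p‖ ≤ l :=
  norm_fderiv_le_of_mem_closure_interior hl (hl'.continuousOn p hpS) hp

lemma norm_gradient_sub_sub_le {F : E → ℝ} {S : Set E} {l : ℝ≥0}
    (hd : ∀ p ∈ S, DifferentiableAt ℝ (gradient F) p) (hl : LipschitzOnWith l (hessian F) S)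
    {p q : E} (hpq : segment ℝ p q ⊆ S) :
    ‖gradient F q - gradient F p - hessian F p (q - p)‖ ≤ l * ‖q - p‖ ^ 2 :=
  norm_sub_sub_fderiv_le hd hl hpq

lemma abs_sub_sub_inner_gradient_le {F : E → ℝ} (hF : Differentiable ℝ F) {S : Set E} {l : ℝ≥0}
    (hl : LipschitzOnWith l (gradient F) S) {p q : E} (hpq : segment ℝ p q ⊆ S) :
    |F q - F p - ⟪gradient F p, q - p⟫_ℝ| ≤ l * ‖q - p‖ ^ 2 := by
  have h1 : LipschitzOnWith l (fderiv ℝ F) S := by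
    have h2 := (InnerProductSpace.toDual ℝ E).lipschitz.comp_lipschitzOnWith hl
    rwa [one_mul, toDual_comp_gradient] at h2
  have h3 := norm_sub_sub_fderiv_le (fun p _ => hF p) h1 hpq
  rwa [← toDual_gradient, InnerProductSpace.toDual_apply_apply, Real.norm_eq_abs] at h3

end Bounds

lemma norm_sum_smul_le_of_le {n : ℕ} {F : Type*} [NormedAddCommGroup F] [NormedSpace ℝ F]
    {v : Vec n} {a : Fin n → F} {k b : ℝ} (hv : ‖v‖ ≤ k) (ha : ∀ i, ‖a i‖ ≤ b) :
    ‖∑ i, v i • a i‖ ≤ k * (n * b) := by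
  refine (norm_sum_smul_le v a).trans ?_
  have h1 : ∑ i, ‖a i‖ ≤ n * b := by
    simpa using Finset.sum_le_card_nsmul Finset.univ (fun i => ‖a i‖) b fun i _ => ha i
  have h2 : 0 ≤ ∑ i, ‖a i‖ := Finset.sum_nonneg fun i _ => norm_nonneg _
  exact mul_le_mul hv h1 h2 ((norm_nonneg v).trans hv)

/-- Energy estimate for the linearized Karush-Kuhn-Tucker system: the solution `(η, ε)` is bounded
by the data `ξ`. The multiplier part `ε` is estimated by `‖pt ξ η‖` through the first equation, and
pairing that equation with `η` gives a quadratic inequality for `‖η‖`. -/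
lemma norm_le_of_linearized {H : Joint dx dy →L[ℝ] Joint dx dy} {a : Fin m → Joint dx dy}
    {ξ : Vec dx} {η : Vec dy} {ε : Vec m} {B b s ν : ℝ} (hν : 0 < ν) (hs : 0 < s)
    (hB : ‖H‖ ≤ B) (hb : 0 ≤ b) (ha : ∀ i, ‖a i‖ ≤ b)
    (hpd : ν * ‖η‖ ^ 2 ≤ ⟪(H (pt 0 η)).snd, η⟫_ℝ)
    (hJ : s * ‖ε‖ ≤ ‖∑ i, ε i • (a i).snd‖)
    (h1 : (H (pt ξ η)).snd + ∑ i, ε i • (a i).snd = 0)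
    (h2 : ∀ i, ε i ≠ 0 → ⟪a i, pt ξ η⟫_ℝ = 0) :
    ‖pt ξ η‖ ≤ (2 + 2 * (B / s * (m * b) + B) / ν) * ‖ξ‖ ∧
      ‖ε‖ ≤ B / s * ((2 + 2 * (B / s * (m * b) + B) / ν) * ‖ξ‖) := by
  have hB0 : 0 ≤ B := (norm_nonneg H).trans hB
  have hH : ∀ p, ‖(H p).snd‖ ≤ B * ‖p‖ := fun p => (norm_snd_le _).trans (H.le_of_opNorm_le hB p)
  have hε : ‖ε‖ ≤ B / s * ‖pt ξ η‖ := by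
    rw [eq_neg_of_add_eq_zero_right h1, norm_neg] at hJ
    rw [div_mul_eq_mul_div, le_div_iff₀ hs, mul_comm]
    exact hJ.trans (hH _)
  have hsplit : (H (pt 0 η)).snd = (H (pt ξ η)).snd - (H (pt ξ 0)).snd := by
    rw [← WithLp.sub_snd, ← map_sub, pt_sub, sub_self, sub_zero]
  have hcoup : ⟪(H (pt ξ η)).snd, η⟫_ℝ = ⟪∑ i, ε i • a i, pt ξ 0⟫_ℝ := by
    rw [eq_neg_of_add_eq_zero_left h1, inner_neg_left, sum_inner, sum_inner,
      ← Finset.sum_neg_distrib]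
    refine Finset.sum_congr rfl fun i _ => ?_
    rw [real_inner_smul_left, real_inner_smul_left]
    by_cases hi : ε i = 0
    · rw [hi]; ring
    · have h3 := h2 i hi
      rw [inner_pt] at h3 ⊢
      rw [inner_zero_right, add_zero, eq_neg_of_add_eq_zero_right h3]
      ring
  have hx : ‖pt ξ (0 : Vec dy)‖ ≤ ‖ξ‖ := by simpa using norm_pt_le ξ (0 : Vec dy)
  have hz := norm_pt_le ξ η
  set q := B / s * (m * b) + B with hq
  have hq0 : 0 ≤ q := by positivity
  have hen : ν * ‖η‖ ^ 2 ≤ q * ‖ξ‖ * (‖ξ‖ + ‖η‖) := by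
    have e1 : ⟪∑ i, ε i • a i, pt ξ (0 : Vec dy)⟫_ℝ ≤ B / s * (‖ξ‖ + ‖η‖) * (m * b) * ‖ξ‖ := by
      refine (real_inner_le_norm _ _).trans ?_
      refine mul_le_mul ?_ hx (norm_nonneg _) (by positivity)
      refine norm_sum_smul_le_of_le (hε.trans ?_) ha
      gcongr
    have e2 : -⟪(H (pt ξ 0)).snd, η⟫_ℝ ≤ B * ‖ξ‖ * ‖η‖ := by
      have e3 := (abs_le.1 (abs_real_inner_le_norm (H (pt ξ 0)).snd η)).1
      have e4 : ‖(H (pt ξ (0 : Vec dy))).snd‖ * ‖η‖ ≤ B * ‖ξ‖ * ‖η‖ := by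
        gcongr
        exact (hH _).trans (by gcongr)
      linarith
    rw [hsplit, inner_sub_left, hcoup] at hpd
    have e5 : 0 ≤ B * ‖ξ‖ * ‖ξ‖ := by positivity
    calc ν * ‖η‖ ^ 2 ≤ B / s * (‖ξ‖ + ‖η‖) * (m * b) * ‖ξ‖ + B * ‖ξ‖ * ‖η‖ := by linarith
      _ ≤ q * ‖ξ‖ * (‖ξ‖ + ‖η‖) := by rw [hq]; linarith
  have hη : ‖η‖ ≤ (1 + 2 * q / ν) * ‖ξ‖ := by
    rcases le_or_gt ‖η‖ ‖ξ‖ with h | h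
    · have : 0 ≤ 2 * q / ν * ‖ξ‖ := by positivity
      linarith
    · have h5 : ν * ‖η‖ ≤ 2 * q * ‖ξ‖ := by
        have h6 : 0 < ‖η‖ := (norm_nonneg ξ).trans_lt h
        refine le_of_mul_le_mul_right ?_ h6
        have h7 : q * ‖ξ‖ * (‖ξ‖ + ‖η‖) ≤ q * ‖ξ‖ * (2 * ‖η‖) := by gcongr; linarith
        linarith
      have h8 : ‖η‖ ≤ 2 * q / ν * ‖ξ‖ := by
        rw [div_mul_eq_mul_div, le_div_iff₀ hν]; linarith
      linarith [norm_nonneg ξ]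
  have hfin : ‖pt ξ η‖ ≤ (2 + 2 * q / ν) * ‖ξ‖ := by linarith
  exact ⟨hfin, hε.trans (by gcongr)⟩

lemma segment_pt_subset_domain {x : Vec dx} (hc : Convex ℝ (P.feasible x)) {y y' : Vec dy}
    (hy : y ∈ P.feasible x) (hy' : y' ∈ P.feasible x) :
    segment ℝ (pt x y) (pt x y') ⊆ P.domain := by
  rintro p ⟨a, b, ha, hb, hab, rfl⟩
  rw [smul_pt, smul_pt, pt_add, ← add_smul, hab, one_smul, pt_mem_domain]
  exact hc hy hy' ha hb hab

lemma inner_lagHess_comm {ψ : Vec dx → Vec dy → ℝ} {ν : ℝ} (hP : P.IsProgram ψ ν)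
    {p : Joint dx dy} (hp : p ∈ P.domain) (lam : Vec m) (u v : Joint dx dy) :
    ⟪P.lagHess ψ lam p u, v⟫_ℝ = ⟪u, P.lagHess ψ lam p v⟫_ℝ := by
  simp only [lagHess, add_apply, sum_apply, smul_apply, inner_add_left, inner_add_right, sum_inner,
    inner_sum, real_inner_smul_left, real_inner_smul_right]
  rw [inner_hessian_comm (hP.contDiff_obj.differentiable one_ne_zero) (hP.diff_obj p hp)]
  congr 1
  refine Finset.sum_congr rfl fun i _ => ?_
  rw [inner_hessian_comm ((hP.contDiff_h i).differentiable one_ne_zero) (hP.diff_h i p hp)]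

end Problem

/-! ### Comparison of the two gradients -/

namespace Constants

/-- Lipschitz constant of the gradient of the Lagrangian `g + ∑ i, lam i * h i`, `‖lam‖ ≤ Λ`. -/
def lagLip (c : Constants) (m : ℕ) : ℝ := c.lg1 + c.Λ * (m * c.lh1)

/-- Lipschitz constant of the Hessian of the Lagrangian `g + ∑ i, lam i * h i`, `‖lam‖ ≤ Λ`. -/
def lagLip₂ (c : Constants) (m : ℕ) : ℝ := c.lg2 + c.Λ * (m * c.lh2)

/-- Displacement, per unit of `t`, of the minimizer of `t f + g` from that of `g`. -/
def minimizerLip (c : Constants) : ℝ := 4 * c.lf0 / c.μg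

/-- Displacement, per unit of `t`, of the multiplier of `t f + g` from that of `g`. -/
def multiplierLip (c : Constants) (m : ℕ) : ℝ :=
  (c.lf0 + (c.μg / 2 + c.lagLip m) * c.minimizerLip) / c.smin

/-- Bound for the derivative of `x ↦ (x, y*(x))`. -/
def primalBound (c : Constants) (m : ℕ) : ℝ :=
  2 + 2 * (c.lagLip m / c.smin * (m * c.lh0) + c.lagLip m) / (c.μg / 2)

/-- Bound for the derivative of the multiplier in `x`. -/
def dualBound (c : Constants) (m : ℕ) : ℝ := c.lagLip m / c.smin * c.primalBound m

/-- The constant in the comparison of `∇Φ` and `∇Φ_δ`. Its summands come from the change of `∇f`,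
the Taylor remainder of the Lagrangian gradient, the values of the active constraints, and the
product of the displacements of multiplier and constraint gradients. -/
def gradGap (c : Constants) (m : ℕ) : ℝ :=
  c.lf1 * c.minimizerLip * c.primalBound m +
    c.lagLip₂ m * c.minimizerLip ^ 2 * c.primalBound m +
    c.dualBound m * (m * (c.lh1 * c.minimizerLip ^ 2)) +
    c.multiplierLip m * (m * (c.lh1 * c.minimizerLip)) * c.primalBound m

end Constants

namespace Problem

variable {dx dy m : ℕ} {P : Problem dx dy m} {c : Constants}

lemma Standing.lagGrad_gPen (hS : P.Standing c) (t : ℝ) (lam : Vec m) (p : Joint dx dy) :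
    P.lagGrad (P.gPen t) lam p = t • gradient (joint P.f) p + P.lagGrad P.g lam p := by
  rw [lagGrad, lagGrad, hS.gradient_gPen, add_assoc]

lemma lagGrad_sub_lagGrad (ψ : Vec dx → Vec dy → ℝ) (lam lam' : Vec m) (p : Joint dx dy) :
    P.lagGrad ψ lam' p - P.lagGrad ψ lam p =
      ∑ i, (lam' - lam) i • gradient (joint (P.h i)) p := by
  simp only [lagGrad, PiLp.sub_apply, sub_smul, Finset.sum_sub_distrib]
  abel

lemma Standing.norm_lagGrad_sub_le (hS : P.Standing c) {lam : Vec m} (hlam : ‖lam‖ ≤ c.Λ)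
    {p q : Joint dx dy} (hp : p ∈ P.domain) (hq : q ∈ P.domain) :
    ‖P.lagGrad P.g lam p - P.lagGrad P.g lam q‖ ≤ c.lagLip m * ‖p - q‖ := by
  have e : P.lagGrad P.g lam p - P.lagGrad P.g lam q =
      (gradient (joint P.g) p - gradient (joint P.g) q) +
        ∑ i, lam i • (gradient (joint (P.h i)) p - gradient (joint (P.h i)) q) := by
    simp only [lagGrad, smul_sub, Finset.sum_sub_distrib]
    abel
  rw [e, Constants.lagLip, add_mul]
  refine (norm_add_le _ _).trans (add_le_add (hS.lip_grad_g.norm_sub_le hp hq) ?_)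
  rw [mul_assoc, mul_assoc]
  exact norm_sum_smul_le_of_le hlam fun i => (hS.lip_grad_h i).norm_sub_le hp hq

lemma add_sum_smul_apply {F : Type*} [NormedAddCommGroup F] [NormedSpace ℝ F] {n : ℕ} (l : Vec n)
    (A : F →L[ℝ] F) (B : Fin n → F →L[ℝ] F) (v : F) :
    (A + ∑ i, l i • B i) v = A v + ∑ i, l i • B i v := by
  simp only [add_apply, sum_apply, smul_apply]

lemma lagHess_apply (ψ : Vec dx → Vec dy → ℝ) (lam : Vec m) (p v : Joint dx dy) :
    P.lagHess ψ lam p v =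
      hessian (joint ψ) p v + ∑ i, lam i • hessian (joint (P.h i)) p v :=
  add_sum_smul_apply lam _ _ v

lemma sub_sub_combination {F : Type*} [AddCommGroup F] [Module ℝ F] {n : ℕ} (l : Vec n)
    (x₁ x₂ x₃ : F) (z₁ z₂ z₃ : Fin n → F) :
    x₁ + ∑ i, l i • z₁ i - (x₂ + ∑ i, l i • z₂ i) - (x₃ + ∑ i, l i • z₃ i) =
      (x₁ - x₂ - x₃) + ∑ i, l i • (z₁ i - z₂ i - z₃ i) := by
  simp only [smul_sub, Finset.sum_sub_distrib]
  abel

lemma Standing.norm_lagGrad_sub_sub_le (hS : P.Standing c) {lam : Vec m} (hlam : ‖lam‖ ≤ c.Λ)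
    {p q : Joint dx dy} (hpq : segment ℝ p q ⊆ P.domain) :
    ‖P.lagGrad P.g lam q - P.lagGrad P.g lam p - P.lagHess P.g lam p (q - p)‖ ≤
      c.lagLip₂ m * ‖q - p‖ ^ 2 := by
  have e := sub_sub_combination lam (gradient (joint P.g) q) (gradient (joint P.g) p)
    (hessian (joint P.g) p (q - p)) (fun i => gradient (joint (P.h i)) q)
    (fun i => gradient (joint (P.h i)) p) (fun i => hessian (joint (P.h i)) p (q - p))
  rw [lagHess_apply, lagGrad, lagGrad]
  rw [e, Constants.lagLip₂, add_mul]
  have h1 := norm_gradient_sub_sub_le hS.hess_g.2 hS.lip_hess_g hpq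
  have h2 := norm_sum_smul_le_of_le hlam fun i =>
    norm_gradient_sub_sub_le (hS.hess_h i).2 (hS.lip_hess_h i) hpq
  rw [mul_assoc, mul_assoc]
  exact (norm_add_le _ _).trans (add_le_add h1 h2)

lemma norm_add_sum_smul_clm_le {F : Type*} [NormedAddCommGroup F] [NormedSpace ℝ F] {n : ℕ}
    {l : Vec n} {A : F →L[ℝ] F} {B : Fin n → F →L[ℝ] F} {a k b : ℝ} (hA : ‖A‖ ≤ a) (hl : ‖l‖ ≤ k)
    (hB : ∀ i, ‖B i‖ ≤ b) : ‖A + ∑ i, l i • B i‖ ≤ a + k * (n * b) :=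
  (norm_add_le _ _).trans (add_le_add hA (norm_sum_smul_le_of_le hl hB))

lemma Standing.norm_lagHess_le (hS : P.Standing c) {lam : Vec m} (hlam : ‖lam‖ ≤ c.Λ)
    {p : Joint dx dy} (hpd : p ∈ P.domain) (hp : p ∈ closure (interior P.domain)) :
    ‖P.lagHess P.g lam p‖ ≤ c.lagLip m := by
  exact norm_add_sum_smul_clm_le
    (norm_hessian_le_of_mem_closure_interior hS.lip_grad_g hS.lip_hess_g hpd hp) hlam fun i =>
      norm_hessian_le_of_mem_closure_interior (hS.lip_grad_h i) (hS.lip_hess_h i) hpd hp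

lemma sum_smul_snd (v : Vec m) (a : Fin m → Joint dx dy) :
    (∑ i, v i • a i).snd = ∑ i, v i • (a i).snd := by
  simp only [← sndL_apply, map_sum, map_smul]

/-- The comparison of the gradients, with an explicit constant. The multipliers `l₀`, `l₁` and the
points `p`, `q` belong to `t = 0` and `t = δ`; `H` is the Hessian of the Lagrangian at `p`. -/
theorem Standing.norm_gradient_sub_le (hS : P.Standing c) (hμ : 0 < c.μg) (hs : 0 < c.smin)
    {δ : ℝ} (hδ : 0 < δ) (hδμ : 2 * (c.lf1 : ℝ) * δ ≤ c.μg) {x : Vec dx}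
    (hR : P.RegularAt c δ x) :
    DifferentiableAt ℝ P.Φ x ∧ DifferentiableAt ℝ (P.ΦPen δ) x ∧
      ‖gradient P.Φ x - gradient (P.ΦPen δ) x‖ ≤ c.gradGap m * δ := by
  have h0μ : 2 * (c.lf1 : ℝ) * 0 ≤ c.μg := by simpa using hμ.le
  have hν : 0 < c.μg / 2 := by positivity
  have hP₁ := hS.isProgram hδ.le hδμ
  have hP₀ : P.IsProgram P.g (c.μg / 2) := gPen_zero (P := P) ▸ hS.isProgram le_rfl h0μ
  have m0 : (0 : ℝ) ∈ Set.Icc 0 δ := ⟨le_rfl, hδ.le⟩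
  have m1 : δ ∈ Set.Icc 0 δ := ⟨hδ.le, le_rfl⟩
  have hY₀ : ∀ u, P.yStar u ∈ P.feasible u ∧ IsMinOn (P.g u) (P.feasible u) (P.yStar u) := by
    intro u
    have := hS.yStarPen_spec hμ le_rfl h0μ u
    rwa [gPen_zero, yStarPen_zero] at this
  have hY₁ := hS.yStarPen_spec hμ hδ.le hδμ
  set y₀ := P.yStar x with hy₀
  set y₁ := P.yStarPen δ x with hy₁
  set I := P.activeSet x y₀ with hI
  have hI₁ : P.activeSet x y₁ = I := hR.active_eq δ m1
  have hL₀ : P.LICQ x y₀ := by have := hR.licq 0 m0; rwa [yStarPen_zero] at this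
  have hL₁ : P.LICQ x y₁ := hR.licq δ m1
  have hJ₀ : P.JacobianLower c.smin x y₀ := by
    have := hR.jacobian 0 m0
    rw [yStarPen_zero] at this
    exact this.jacobianLower hs.le hL₀
  have hJ₁ : P.JacobianLower c.smin x y₁ := (hR.jacobian δ m1).jacobianLower hs.le hL₁
  obtain ⟨l₀, hl₀⟩ := hL₀.exists_isKKT hP₀.contDiff_h hP₀.contDiff_obj (hY₀ x).1 (hY₀ x).2
  obtain ⟨l₁, hl₁⟩ := hL₁.exists_isKKT hP₁.contDiff_h hP₁.contDiff_obj (hY₁ x).1 (hY₁ x).2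
  have hmul₀ : P.IsMultiplier 0 x (P.yStarPen 0 x) l₀ := by
    have : P.IsKKT (P.gPen 0) x (P.yStarPen 0 x) l₀ := by rw [gPen_zero, yStarPen_zero]; exact hl₀
    exact this
  have hΛ₀ : ‖l₀‖ ≤ c.Λ := hR.mult_le 0 m0 l₀ hmul₀
  have hΛ₁ : ‖l₁‖ ≤ c.Λ := hR.mult_le δ m1 l₁ hl₁
  have hpos₀ : ∀ i ∈ P.activeSet x y₀, 0 < l₀ i := hR.strict_compl 0 m0 l₀ hmul₀
  have hpos₁ : ∀ i ∈ P.activeSet x y₁, 0 < l₁ i := by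
    rw [hI₁]; exact hR.strict_compl δ m1 l₁ hl₁
  obtain ⟨D, E, hD, hDE⟩ := hP₀.exists_hasFDerivAt hν (fun u => (hY₀ u).1) (fun u => (hY₀ u).2)
    hL₀ hs hJ₀ hl₀ hpos₀
  obtain ⟨D₁, E₁, hD₁, hDE₁⟩ := hP₁.exists_hasFDerivAt hν (fun u => (hY₁ u).1) (fun u => (hY₁ u).2)
    hL₁ hs hJ₁ hl₁ hpos₁
  set p := pt x y₀ with hp
  set q := pt x y₁ with hq
  have hpd : p ∈ P.domain := (hY₀ x).1
  have hqd : q ∈ P.domain := (hY₁ x).1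
  have hpc : p ∈ closure (interior P.domain) :=
    hL₀.mem_closure_interior hP₀.contDiff_h (hY₀ x).1
  have hseg : segment ℝ p q ⊆ P.domain :=
    segment_pt_subset_domain (hS.convex x) (hY₀ x).1 (hY₁ x).1
  -- differentiability and the formulas for the gradients
  have hΦ := hasFDerivAt_along (hS.hess_f.1.differentiable one_ne_zero p) hD
  have hv₀ := hasFDerivAt_along (hS.hess_g.1.differentiable one_ne_zero p) hD
  have hv₁ := hasFDerivAt_along ((hS.contDiff_gPen δ).differentiable one_ne_zero q) hD₁
  have hg₀ := hP₀.gradient_value hl₀ hD fun ξ => (hDE ξ).2.1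
  have hg₁ := hP₁.gradient_value hl₁ hD₁ fun ξ => (hDE₁ ξ).2.1
  have hΦP : HasGradientAt (P.ΦPen δ)
      (δ⁻¹ • ((P.lagGrad (P.gPen δ) l₁ q).fst - (P.lagGrad P.g l₀ p).fst)) x := by
    rw [hS.ΦPen_eq hμ hδ hδμ]
    simp_rw [gPen_zero, yStarPen_zero]
    have h1 := hv₁.1.hasGradientAt.hasFDerivAt.sub hv₀.1.hasGradientAt.hasFDerivAt
    rw [hg₀, hg₁, ← map_sub] at h1
    rw [hasGradientAt_iff_hasFDerivAt, map_smul]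
    exact h1.const_mul δ⁻¹
  refine ⟨hΦ.1, hΦP.differentiableAt, ?_⟩
  rw [hΦP.gradient]
  -- sizes of the displacements of minimizer and multiplier
  set k := c.minimizerLip with hk
  have hk0 : 0 ≤ k := by rw [hk, Constants.minimizerLip]; positivity
  have hK₁0 : (P.lagGrad (P.gPen δ) l₁ q).snd = 0 := (hP₁.lagGrad_snd l₁ x y₁).trans hl₁.2.2
  have hK₀0 : (P.lagGrad P.g l₀ p).snd = 0 := (hP₀.lagGrad_snd l₀ x y₀).trans hl₀.2.2
  have hf0 : ‖gradient (joint P.f) p‖ ≤ c.lf0 :=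
    norm_gradient_le_of_mem_closure_interior hS.hess_f.1 hS.lip_f hpc
  -- `(y₀, l₀)` satisfies the conditions for `t = δ` up to the residual `δ • ∇f`
  have hΔ : ‖q - p‖ ≤ k * δ := by
    have h1 := hP₁.norm_sub_sq_le hν (hY₀ x).1 (hY₁ x).1 ((hY₁ x).2 (hY₀ x).1) hl₀.1
    rw [Finset.sum_eq_zero fun i _ => hl₀.2.1 i, sub_zero, hS.lagGrad_gPen, smul_add_snd, hK₀0,
      add_zero, norm_smul, Real.norm_of_nonneg hδ.le] at h1
    have h2 : ‖(gradient (joint P.f) p).snd‖ ≤ c.lf0 := (norm_snd_le _).trans hf0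
    have h3 : ‖q - p‖ = ‖y₁ - y₀‖ := by rw [hp, hq, pt_sub, sub_self, norm_pt_zero]
    rw [h3]
    refine abs_le_of_sq_le_sq' ?_ (by positivity) |>.2
    have h4 : (δ * ‖(gradient (joint P.f) p).snd‖) ^ 2 ≤ (δ * c.lf0) ^ 2 := by gcongr
    have h5 : c.μg / 2 / 4 * ‖y₁ - y₀‖ ^ 2 ≤ (δ * c.lf0) ^ 2 / (c.μg / 2) :=
      h1.trans (by gcongr)
    have h6 : (k * δ) ^ 2 = (δ * c.lf0) ^ 2 / (c.μg / 2) / (c.μg / 2 / 4) := by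
      rw [hk, Constants.minimizerLip]; field_simp; ring
    rw [h6, le_div_iff₀ (by positivity), mul_comm]
    exact h5
  set v := l₁ - l₀ with hv
  have hvI : ∀ i ∉ I, v i = 0 := by
    intro i hi
    rw [hv, PiLp.sub_apply, hl₀.eq_zero_of_notMem hi, hl₁.eq_zero_of_notMem (by rwa [hI₁]),
      sub_zero]
  set a : Fin m → Joint dx dy := fun i => gradient (joint (P.h i)) p with ha
  have hgr : ∀ i, gradient (P.h i x) y₀ = (a i).snd := fun i =>
    gradient_eq_snd ((hP₀.contDiff_h i).differentiable one_ne_zero) _ _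
  have hJ : ∀ w : Vec m, (∀ i ∉ I, w i = 0) → c.smin * ‖w‖ ≤ ‖∑ i, w i • (a i).snd‖ := by
    intro w hw
    have := hJ₀ w hw
    simp_rw [hgr] at this
    exact this
  have hfL : ‖gradient (joint P.f) q - gradient (joint P.f) p‖ ≤ c.lf1 * ‖q - p‖ :=
    hS.lip_grad_f.norm_sub_le hqd hpd
  -- subtract the two stationarity conditions and express the result through gradients at `p`
  have hvk : ‖v‖ ≤ c.multiplierLip m * δ := by
    have e : ∑ i, v i • (a i).snd = (-(δ • gradient (joint P.f) p +
        δ • (gradient (joint P.f) q - gradient (joint P.f) p) +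
        (P.lagGrad P.g l₁ q - P.lagGrad P.g l₁ p))).snd := by
      have h1 : ∑ i, v i • a i = P.lagGrad P.g l₁ p - P.lagGrad P.g l₀ p :=
        (lagGrad_sub_lagGrad P.g l₀ l₁ p).symm
      have h2 : -(δ • gradient (joint P.f) p +
          δ • (gradient (joint P.f) q - gradient (joint P.f) p) +
          (P.lagGrad P.g l₁ q - P.lagGrad P.g l₁ p)) =
          P.lagGrad P.g l₁ p - P.lagGrad (P.gPen δ) l₁ q := by
        rw [hS.lagGrad_gPen, smul_sub]; abel
      rw [← sum_smul_snd, h1, h2, WithLp.sub_snd, WithLp.sub_snd, hK₁0, hK₀0]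
    have h3 := hJ v hvI
    rw [e] at h3
    have h4 : ‖δ • gradient (joint P.f) p +
        δ • (gradient (joint P.f) q - gradient (joint P.f) p) +
        (P.lagGrad P.g l₁ q - P.lagGrad P.g l₁ p)‖ ≤
        δ * c.lf0 + δ * (c.lf1 * ‖q - p‖) + c.lagLip m * ‖q - p‖ := by
      refine (norm_add₃_le).trans ?_
      rw [norm_smul, norm_smul, Real.norm_of_nonneg hδ.le]
      have := hS.norm_lagGrad_sub_le hΛ₁ hqd hpd
      gcongr
    have h5 := (norm_snd_le _).trans ((norm_neg _).le.trans h4)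
    have hLip : 0 ≤ c.lagLip m := (norm_nonneg _).trans (hS.norm_lagHess_le hΛ₀ hpd hpc)
    rw [Constants.multiplierLip, div_mul_eq_mul_div, le_div_iff₀ hs]
    have h6 : δ * (c.lf1 * ‖q - p‖) ≤ c.μg / 2 * ‖q - p‖ := by
      rw [← mul_assoc]
      gcongr
      linarith
    have h7 : (c.μg / 2 + c.lagLip m) * ‖q - p‖ ≤ (c.μg / 2 + c.lagLip m) * (k * δ) := by gcongr
    linarith
  -- pair the difference of the gradients with an arbitrary direction
  set H := P.lagHess P.g l₀ p with hH
  set w := gradient P.Φ x -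
    δ⁻¹ • ((P.lagGrad (P.gPen δ) l₁ q).fst - (P.lagGrad P.g l₀ p).fst) with hw
  have key : ∀ ξ, δ * ⟪w, ξ⟫_ℝ ≤ δ * (c.gradGap m * δ * ‖ξ‖) := by
    intro ξ
    obtain ⟨hE1, hE2, hE3⟩ := hDE ξ
    set ζ := pt ξ (D ξ) with hζ
    set ε := E ξ with hε
    have hlin : (H ζ).snd + ∑ i, ε i • (a i).snd = 0 := by
      rw [← sum_smul_snd, ← WithLp.add_snd]; exact hE1
    obtain ⟨hζb, hεb⟩ := norm_le_of_linearized hν hs (hS.norm_lagHess_le hΛ₀ hpd hpc)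
      c.lh0.coe_nonneg
      (fun i => norm_gradient_le_of_mem_closure_interior (hS.hess_h i).1 (hS.lip_h i) hpc)
      (hP₀.le_inner_lagHess hpd hpc hl₀.1 (D ξ)) (hJ ε hE3) hlin
      (fun i hi => hE2 i (by_contra fun h => hi (hE3 i h)))
    replace hζb : ‖ζ‖ ≤ c.primalBound m * ‖ξ‖ := hζb
    replace hεb : ‖ε‖ ≤ c.dualBound m * ‖ξ‖ := by
      rw [Constants.dualBound, mul_assoc]; exact hεb
    -- the multiplier part of the displacement is orthogonal to the tangent direction `ζ`
    have hT3 : ⟪∑ i, v i • a i, ζ⟫_ℝ = 0 := by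
      rw [sum_inner]
      refine Finset.sum_eq_zero fun i _ => ?_
      rw [real_inner_smul_left]
      by_cases hi : i ∈ I
      · rw [hE2 i hi, mul_zero]
      · rw [hvI i hi, zero_mul]
    -- by symmetry of the Hessian, the displacement of the minimizer is paired with active
    -- gradients, to which it is orthogonal up to second order
    have hHζ : ⟪H (q - p), ζ⟫_ℝ = -∑ i, ε i * ⟪a i, q - p⟫_ℝ := by
      rw [hH, inner_lagHess_comm hP₀ hpd, ← hH, real_inner_comm, hp, hq, pt_sub, sub_self, inner_pt,
        inner_zero_right, zero_add, eq_neg_of_add_eq_zero_left hlin, inner_neg_left, sum_inner]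
      congr 1
      refine Finset.sum_congr rfl fun i _ => ?_
      rw [real_inner_smul_left, inner_pt, inner_zero_right, zero_add]
    have hact : ∀ i ∈ I, |⟪a i, q - p⟫_ℝ| ≤ c.lh1 * ‖q - p‖ ^ 2 := by
      intro i hi
      have h1 := abs_sub_sub_inner_gradient_le ((hP₀.contDiff_h i).differentiable one_ne_zero)
        (hS.lip_grad_h i) hseg
      have e0 : joint (P.h i) p = 0 := P.mem_activeSet.1 hi
      have e1 : joint (P.h i) q = 0 := P.mem_activeSet.1 (show i ∈ P.activeSet x y₁ by rwa [hI₁])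
      rw [e0, e1, sub_zero, zero_sub, abs_neg] at h1
      exact h1
    have hΔ2 : ‖q - p‖ ^ 2 ≤ (k * δ) ^ 2 := by gcongr
    have hT2 : -⟪H (q - p), ζ⟫_ℝ ≤ c.dualBound m * ‖ξ‖ * (m * (c.lh1 * (k * δ) ^ 2)) := by
      rw [hHζ, neg_neg]
      have h1 : ∀ i ∈ Finset.univ, ε i * ⟪a i, q - p⟫_ℝ ≤
          c.dualBound m * ‖ξ‖ * (c.lh1 * (k * δ) ^ 2) := by
        intro i _
        have hd0 : 0 ≤ c.dualBound m * ‖ξ‖ := (norm_nonneg _).trans hεb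
        by_cases hi : i ∈ I
        · refine (le_abs_self _).trans ?_
          rw [abs_mul]
          refine mul_le_mul ((abs_coord_le ε i).trans hεb) ((hact i hi).trans ?_) (abs_nonneg _) hd0
          gcongr
        · rw [hE3 i hi, zero_mul]
          positivity
      have h2 := Finset.sum_le_card_nsmul _ _ _ h1
      rw [Finset.card_univ, Fintype.card_fin, nsmul_eq_mul] at h2
      linarith
    have hζ0 : 0 ≤ c.primalBound m * ‖ξ‖ := (norm_nonneg _).trans hζb
    have hpair : ∀ {u : Joint dx dy} {r : ℝ}, ‖u‖ ≤ r → -⟪u, ζ⟫_ℝ ≤ r * (c.primalBound m * ‖ξ‖) :=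
      fun {u r} hu => (neg_le_abs _).trans <| (abs_real_inner_le_norm u ζ).trans
        (mul_le_mul hu hζb (norm_nonneg _) ((norm_nonneg _).trans hu))
    have hT1 := hpair (u := δ • (gradient (joint P.f) q - gradient (joint P.f) p))
      (r := δ * (c.lf1 * (k * δ))) (by
        rw [norm_smul, Real.norm_of_nonneg hδ.le]
        exact mul_le_mul_of_nonneg_left (hfL.trans (by gcongr)) hδ.le)
    have hLip₂ : ‖P.lagGrad P.g l₀ q - P.lagGrad P.g l₀ p - H (q - p)‖ ≤
        c.lagLip₂ m * (k * δ) ^ 2 := by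
      refine (hS.norm_lagGrad_sub_sub_le hΛ₀ hseg).trans ?_
      have : 0 ≤ c.lagLip₂ m := by
        have := (norm_nonneg _).trans hΛ₀
        rw [Constants.lagLip₂]
        positivity
      gcongr
    have hT4 := hpair (norm_sum_smul_le_of_le hvk
      (fun i => ((hS.lip_grad_h i).norm_sub_le hqd hpd).trans
        (mul_le_mul_of_nonneg_left hΔ (c.lh1).coe_nonneg)))
    have hT5 := hpair hLip₂
    have hsum : δ • gradient (joint P.f) p -
        (P.lagGrad (P.gPen δ) l₁ q - P.lagGrad P.g l₀ p) =
        -(δ • (gradient (joint P.f) q - gradient (joint P.f) p)) -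
          (P.lagGrad P.g l₀ q - P.lagGrad P.g l₀ p - H (q - p)) - H (q - p) -
          (∑ i, v i • a i) -
          ∑ i, v i • (gradient (joint (P.h i)) q - gradient (joint (P.h i)) p) := by
      have h1 : P.lagGrad P.g l₁ q = P.lagGrad P.g l₀ q +
          ∑ i, v i • gradient (joint (P.h i)) q :=
        (sub_eq_iff_eq_add'.1 (lagGrad_sub_lagGrad P.g l₀ l₁ q))
      simp only [smul_sub, Finset.sum_sub_distrib]
      rw [hS.lagGrad_gPen, h1]
      abel
    have hpairing : δ * ⟪w, ξ⟫_ℝ = ⟪δ • gradient (joint P.f) p -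
        (P.lagGrad (P.gPen δ) l₁ q - P.lagGrad P.g l₀ p), ζ⟫_ℝ := by
      have h1 : ⟪P.lagGrad (P.gPen δ) l₁ q - P.lagGrad P.g l₀ p, ζ⟫_ℝ =
          ⟪(P.lagGrad (P.gPen δ) l₁ q).fst - (P.lagGrad P.g l₀ p).fst, ξ⟫_ℝ := by
        rw [hζ, inner_pt, WithLp.sub_snd, hK₁0, hK₀0, sub_self, inner_zero_left, add_zero,
          WithLp.sub_fst]
      have h2 : ⟪gradient P.Φ x, ξ⟫_ℝ = ⟪gradient (joint P.f) p, ζ⟫_ℝ := hΦ.2 ξ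
      rw [inner_sub_left (δ • gradient (joint P.f) p), h1, real_inner_smul_left, hw,
        inner_sub_left (gradient P.Φ x), h2, real_inner_smul_left,
        mul_sub, mul_inv_cancel_left₀ hδ.ne']
    rw [hpairing, hsum, inner_sub_left, inner_sub_left, inner_sub_left, inner_sub_left,
      inner_neg_left, hT3, Constants.gradGap, ← hk]
    linarith
  have h1 := le_of_mul_le_mul_left (key w) hδ
  rw [real_inner_self_eq_norm_sq, pow_two] at h1
  rcases (norm_nonneg w).eq_or_lt with h0 | h0
  · have hLip : 0 ≤ c.lagLip m := (norm_nonneg _).trans (hS.norm_lagHess_le hΛ₀ hpd hpc)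
    have hΛ0 : 0 ≤ c.Λ := (norm_nonneg _).trans hΛ₀
    rw [← h0]
    have h2 : 0 ≤ c.lagLip₂ m := by rw [Constants.lagLip₂]; positivity
    have h3 : 0 ≤ c.primalBound m := by rw [Constants.primalBound]; positivity
    have h4 : 0 ≤ c.dualBound m := by rw [Constants.dualBound]; positivity
    have h5 : 0 ≤ c.multiplierLip m := by rw [Constants.multiplierLip, ← hk]; positivity
    rw [Constants.gradGap, ← hk]
    positivity
  · exact le_of_mul_le_mul_right h1 h0

end Problem

end CoupledBilevel

end

theorem mainTheorem1 (m : ℕ) (c : CoupledBilevel.Constants) (hμ : 0 < c.μg)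
    (hs : 0 < c.smin) :
    ∃ C : ℝ, ∀ (dx dy : ℕ) (P : CoupledBilevel.Problem dx dy m), P.Standing c →
      ∀ δ : ℝ, 0 < δ → 2 * (c.lf1 : ℝ) * δ ≤ c.μg →
      ∀ x : CoupledBilevel.Vec dx, P.RegularAt c δ x →
        DifferentiableAt ℝ P.Φ x ∧ DifferentiableAt ℝ (P.ΦPen δ) x ∧
          ‖gradient P.Φ x - gradient (P.ΦPen δ) x‖ ≤ C * δ :=
  ⟨c.gradGap m, fun _ _ _ hS _ hδ hδμ _ hR => hS.norm_gradient_sub_le hμ hs hδ hδμ hR⟩
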